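/- Let $G$ be a finite simple graph with vertex set $V$ and distance $d$ (with $d(x,y)=\infty$ if $x$ and $y$ lie in different components). For $B\subseteq V$ and $x\in V$, let $r(x)$ be the ordered partition of $B$ into the classes of vertices at equal distance from $x$, listed by increasing distance. The set $B$ is a centroidal locating set of $G$ if $r(x)\ne r(y)$ for all distinct $x,y\in V$; the centroidal dimension $CD(G)$ is the minimum size of such a set. (1) The problem Centroidal Dimension (given $G$, find a centroidal locating set of minimum size) is $O(\sqrt{n\ln n})$-approximable: there are a function $\alpha:\mathbb N\to\mathbb R$ with $\alpha(n)=O(\sqrt{n\ln n})$ and a polynomial-time algorithm (on a multi-stack Turing machine, with the graph given by its adjacency matrix) which, for every graph $G$ on $n$ vertices, outputs a centroidal locating set of $G$ of size at most $\alpha(n)\cdot CD(G)$. (2) Say that a pair $\{b_1,b_2\}$ of distinct vertices identifies a pair $\{x,y\}$ of distinct vertices if, for some naming of the elements of both pairs, $d(x,b_1)\le d(x,b_2)$ and $d(y,b_1)>d(y,b_2)$. Let $H$ be the hypergraph whose vertices are the 2-element subsets of $V$ and which has, for each 2-element subset $q$ of $V$, a hyperedge $E_q$ (indexed by $q$) consisting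 of the pairs identified by $q$. Let $SC(H)$ be the minimum number of hyperedges that cover all vertices of $H$. Then $SC(H)\le\binom{CD(G)}{2}$. Moreover, for each set cover $C$ of $H$, the union $B(C)$ of the pairs $q$ with $E_q\in C$ is a centroidal locating set of $G$ with $|B(C)|\le 2|C|$. -/

import Mathlib

/-! Distances are extended distances, so that a vertex in another component is infinitely far away;
on connected graphs they are the usual graph distances. -/

/-- The rank ordering `r(x)` of `B`: the ordered partition of `B` into the classes of vertices at
equal distance from `x`, listed by increasing distance from `x`. -/
noncomputable def rankOrdering {V : Type*} (G : SimpleGraph V) (B : Finset V) (x : V) :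
    List (Finset V) :=
  ((B.image (G.edist x)).sort (· ≤ ·)).map fun d => B.filter fun b => G.edist x b = d

/-- `B` is a centroidal locating set: distinct vertices have distinct rank orderings of `B`. -/
def IsCentroidalLocating {V : Type*} (G : SimpleGraph V) (B : Finset V) : Prop :=
  ∀ x y : V, x ≠ y → rankOrdering G B x ≠ rankOrdering G B y

/-- The centroidal dimension `CD(G)`: the least size of a centroidal locating set. -/
noncomputable def centroidalDim {V : Type*} (G : SimpleGraph V) : ℕ :=
  sInf {k | ∃ B : Finset V, IsCentroidalLocating G B ∧ B.card = k}

/-- A subfamily `C` of the family `E` of hyperedges covers the whole vertex set `X`. -/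
def IsSetCover {ι X : Type*} (E : ι → Set X) (C : Finset ι) : Prop :=
  ∀ p : X, ∃ i ∈ C, p ∈ E i

/-- The least size of a set cover. -/
noncomputable def setCoverNumber {ι X : Type*} (E : ι → Set X) : ℕ :=
  sInf {k | ∃ C : Finset ι, IsSetCover E C ∧ C.card = k}

/-- Unordered pairs of distinct vertices. -/
abbrev VertexPair (V : Type*) : Type _ := {p : Finset V // p.card = 2}

/-- The pair `q = {b₁, b₂}` identifies the pair `p = {x, y}`: for one of the namings of the two
elements of each pair, `d(x, b₁) ≤ d(x, b₂)` but `d(y, b₁) > d(y, b₂)`. -/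
def Identifies {V : Type*} (G : SimpleGraph V) (q p : VertexPair V) : Prop :=
  ∃ b₁ ∈ q.1, ∃ b₂ ∈ q.1, ∃ x ∈ p.1, ∃ y ∈ p.1,
    G.edist x b₁ ≤ G.edist x b₂ ∧ G.edist y b₂ < G.edist y b₁

/-- The hypergraph `H(G)`: its vertices are the pairs of vertices of `G`, and it has one hyperedge
for each pair `q`, which consists of the pairs that `q` identifies. -/
def pairHypergraph {V : Type*} (G : SimpleGraph V) (q : VertexPair V) : Set (VertexPair V) :=
  {p | Identifies G q p}

/-- `B(C)`: the union of the pairs whose hyperedges belong to `C`. -/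
def pairUnion {V : Type*} [DecidableEq V] (C : Finset (VertexPair V)) : Finset V :=
  C.biUnion fun q => q.1

open Classical in
/-- A graph on `n` vertices as a word: the rows of its adjacency matrix (entry `some b`), each
terminated by the separator `none`. -/
noncomputable def encodeGraph (G : Σ n : ℕ, SimpleGraph (Fin n)) : List (Option Bool) :=
  (List.finRange G.1).flatMap fun i =>
    ((List.finRange G.1).map fun j => some (decide (G.2.Adj i j))) ++ [none]

/-- A set of vertices as a word: its characteristic vector. -/
def encodeVertexSet (S : Σ n : ℕ, Finset (Fin n)) : List Bool :=
  (List.finRange S.1).map fun i => decide (i ∈ S.2)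

/-- A function from graphs to sets of their vertices is computable in polynomial time, by a
multi-stack Turing machine. -/
def IsPolyTime (A : ∀ n : ℕ, SimpleGraph (Fin n) → Finset (Fin n)) : Prop :=
  Nonempty (Turing.TM2ComputableInPolyTime encodeGraph encodeVertexSet
    fun G : Σ n : ℕ, SimpleGraph (Fin n) => (⟨G.1, A G.1 G.2⟩ : Σ n : ℕ, Finset (Fin n)))

/-- `A` is an `α`-approximation algorithm for Centroidal Dimension: it runs in polynomial time and
on each graph with `n` vertices it outputs a centroidal locating set of size at most `α n` times the
minimum size. -/
def IsCentroidalApproxAlgorithm (α : ℕ → ℝ)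
    (A : ∀ n : ℕ, SimpleGraph (Fin n) → Finset (Fin n)) : Prop :=
  IsPolyTime A ∧ ∀ (n : ℕ) (G : SimpleGraph (Fin n)),
    IsCentroidalLocating G (A n G) ∧ ((A n G).card : ℝ) ≤ α n * (centroidalDim G : ℝ)

/-! A rank ordering records nothing but strict comparisons of distances: `r(x) = r(y)` holds exactly
when `d(x,a) < d(x,b)` and `d(y,a) < d(y,b)` are equivalent for all `a, b` in `B`
(`rankOrdering_eq_iff`). So `B` is centroidal locating if and only if the pairs inside `B` form a
set cover of `H`. The 2-element subsets of an optimal `B` give the binomial bound, and the union of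
the pairs of any cover is a centroidal locating set; this is part (2).

For part (1), the greedy set cover is run on ordered pairs. An optimal `B` yields a cover by at most
`CD(G)²` ordered pairs of a universe of at most `n²` points, so the greedy cover has at most `CD(G)²
(1 + 2 ln n)` members, and the set `S` of their entries satisfies `|S| ≤ 2 (1 + 2 ln n) CD(G)²`.
Trivially `|S| ≤ n` as well. The product of the two bounds is `|S|² ≤ 2n (1 + 2 ln n) CD(G)²`, whose
square root is the claim (`card_solution_le`).

The greedy algorithm never searches for a best set. It lets a threshold `t` decrease and takes every
set that covers more than `t` new points. The potential `#C + #D · H(u)`, with `D` any cover, `u`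
the number of uncovered points and `H` the harmonic numbers, does not increase
(`potential_greedyStep`), which gives the usual logarithmic factor.

Polynomial time is proved by an explicit machine. A small language with registers, bit arrays and
bounded loops is compiled to structured stack programs, and these to multi-stack machines
(`Runs.steps`). No command can lift the registers above their initial bound, so every command has a
cost polynomial (`Cmd.exec_compile`). The algorithm itself compares distances by growing balls in
rounds (`layer_compareAll`) and then simulates the greedy cover (`represents_greedy`). -/

namespace StackProgram

/-! ### Structured programs over finitely many stacks of bits -/

/-- The finite memory of a machine: the symbol popped last. -/
abbrev Cell : Type := Option (Option Bool)

/-- Structured programs that read an input stack and work on bit stacks named by `B`. -/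
inductive Prog (B : Type) : Type
  | skip : Prog B
  | push : B → (Cell → Bool) → Prog B
  | pop : B → Prog B
  | popInput : Prog B
  | seq : Prog B → Prog B → Prog B
  | ite : (Cell → Bool) → Prog B → Prog B → Prog B
  | loop : (Cell → Bool) → Prog B → Prog B

/-- A store: the last symbol popped, the unread input, and the bit stacks. -/
@[ext] structure Store (B : Type) : Type where
  cell : Cell
  inp : List (Option Bool)
  stk : B → List Bool

variable {B : Type} [DecidableEq B]

/-- `Runs p s s' t`: started in `s`, the program `p` halts in `s'` after `t` steps. -/
inductive Runs : Prog B → Store B → Store B → ℕ → Prop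
  | skip (s) : Runs .skip s s 1
  | push (k f s) :
      Runs (.push k f) s ⟨s.cell, s.inp, Function.update s.stk k (f s.cell :: s.stk k)⟩ 1
  | pop (k s) :
      Runs (.pop k) s ⟨(s.stk k).head?.map some, s.inp, Function.update s.stk k (s.stk k).tail⟩ 1
  | popInput (s) : Runs .popInput s ⟨s.inp.head?, s.inp.tail, s.stk⟩ 1
  | seq {p q s s' s'' a b} : Runs p s s' a → Runs q s' s'' b → Runs (.seq p q) s s'' (a + b)
  | ite_true {f p q s s' a} : f s.cell = true → Runs p s s' a → Runs (.ite f p q) s s' (1 + a)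
  | ite_false {f p q s s' a} : f s.cell = false → Runs q s s' a → Runs (.ite f p q) s s' (1 + a)
  | loop_done {f p s} : f s.cell = false → Runs (.loop f p) s s 1
  | loop_step {f p s s' s'' a b} : f s.cell = true → Runs p s s' a →
      Runs (.loop f p) s' s'' b → Runs (.loop f p) s s'' (1 + (a + b))

/-! ### Compilation of structured programs to multi-stack machines -/

namespace Prog

/-- The alphabets of the stacks; the input stack is `none`. -/
def Alphabet (B : Type) : Option B → Type
  | none => Option Bool
  | some _ => Bool

/-- The labels of the compiled program. -/
def Label : Prog B → Type
  | .skip => Unit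
  | .push _ _ => Unit
  | .pop _ => Unit
  | .popInput => Unit
  | .seq p q => p.Label ⊕ q.Label
  | .ite _ p q => Option (p.Label ⊕ q.Label)
  | .loop _ p => Option p.Label

/-- A program has finitely many labels. -/
@[reducible] def fintypeLabel : (p : Prog B) → Fintype p.Label
  | .skip => inferInstanceAs (Fintype Unit)
  | .push _ _ => inferInstanceAs (Fintype Unit)
  | .pop _ => inferInstanceAs (Fintype Unit)
  | .popInput => inferInstanceAs (Fintype Unit)
  | .seq p q =>
    letI := p.fintypeLabel
    letI := q.fintypeLabel
    inferInstanceAs (Fintype (p.Label ⊕ q.Label))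
  | .ite _ p q =>
    letI := p.fintypeLabel
    letI := q.fintypeLabel
    inferInstanceAs (Fintype (Option (p.Label ⊕ q.Label)))
  | .loop _ p =>
    letI := p.fintypeLabel
    inferInstanceAs (Fintype (Option p.Label))

/-- The label at which the compiled program is entered. -/
def entry : (p : Prog B) → p.Label
  | .skip => ()
  | .push _ _ => ()
  | .pop _ => ()
  | .popInput => ()
  | .seq p _ => Sum.inl p.entry
  | .ite _ _ _ => none
  | .loop _ _ => none

open Turing.TM2 in
/-- The code of the compiled program: its labels are embedded by `e`, and it leaves to `next`. -/
def code {Λ : Type} : (p : Prog B) → (p.Label → Λ) → Λ → p.Label → Stmt (Alphabet B) Λ Cell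
  | .skip, _, next => fun _ => .goto fun _ => next
  | .push k f, _, next => fun _ => .push (some k) f (.goto fun _ => next)
  | .pop k, _, next => fun _ =>
      .pop (some k) (fun _ o => Option.map some (o : Option Bool)) (.goto fun _ => next)
  | .popInput, _, next => fun _ =>
      .pop none (fun _ o => (o : Option (Option Bool))) (.goto fun _ => next)
  | .seq p q, e, next =>
      Sum.elim (p.code (e ∘ Sum.inl) (e (Sum.inr q.entry))) (q.code (e ∘ Sum.inr) next)
  | .ite f p q, e, next => fun l =>
      match l with
      | none => .branch f (.goto fun _ => e (some (Sum.inl p.entry)))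
          (.goto fun _ => e (some (Sum.inr q.entry)))
      | some (Sum.inl l) => p.code (fun l => e (some (Sum.inl l))) next l
      | some (Sum.inr l) => q.code (fun l => e (some (Sum.inr l))) next l
  | .loop f p, e, next => fun l =>
      match l with
      | none => .branch f (.goto fun _ => e (some p.entry)) (.goto fun _ => next)
      | some l => p.code (fun l => e (some l)) (e none) l

end Prog

/-- The stacks of a machine in a given store. -/
def Store.stacks (s : Store B) : (k : Option B) → List (Prog.Alphabet B k)
  | none => s.inp
  | some k => s.stk k

theorem stacks_mk_inp (s : Store B) (c : Cell) (l : List (Option Bool)) :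
    Store.stacks ⟨c, l, s.stk⟩ = Function.update s.stacks none l := by
  funext k
  rcases k with _ | k
  · exact (Function.update_self (β := fun k => List (Prog.Alphabet B k)) none l s.stacks).symm
  · exact (Function.update_of_ne (β := fun k => List (Prog.Alphabet B k)) (Option.some_ne_none k) l
      s.stacks).symm

theorem stacks_mk_update (s : Store B) (c : Cell) (k : B) (l : List Bool) :
    Store.stacks ⟨c, s.inp, Function.update s.stk k l⟩ = Function.update s.stacks (some k) l := by
  funext k'
  rcases k' with _ | k'
  · exact (Function.update_of_ne (β := fun k => List (Prog.Alphabet B k))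
      (Option.some_ne_none k).symm l
      s.stacks).symm
  · by_cases h : k' = k
    · subst h
      exact (Function.update_self k' l s.stk).trans
        (Function.update_self (β := fun k => List (Prog.Alphabet B k)) (some k') l s.stacks).symm
    · exact (Function.update_of_ne h l s.stk).trans
        (Function.update_of_ne (β := fun k => List (Prog.Alphabet B k))
            (fun e => h (Option.some.inj e)) l
          s.stacks).symm

/-- `t` steps of the machine `M` lead from `c` to `c'`. -/
def Steps {Λ : Type} (M : Λ → Turing.TM2.Stmt (Prog.Alphabet B) Λ Cell) (t : ℕ)
    (c c' : Turing.TM2.Cfg (Prog.Alphabet B) Λ Cell) : Prop :=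
  (flip bind (Turing.TM2.step M))^[t] (some c) = some c'

theorem Steps.trans {Λ : Type} {M : Λ → Turing.TM2.Stmt (Prog.Alphabet B) Λ Cell} {t t' : ℕ}
    {c c' c'' : Turing.TM2.Cfg (Prog.Alphabet B) Λ Cell} (h : Steps M t c c')
    (h' : Steps M t' c' c'') : Steps M (t + t') c c'' := by
  unfold Steps at *
  rw [Nat.add_comm, Function.iterate_add_apply, h, h']

theorem steps_one {Λ : Type} {M : Λ → Turing.TM2.Stmt (Prog.Alphabet B) Λ Cell}
    {l : Λ} {v : Cell} {S : (k : Option B) → List (Prog.Alphabet B k)}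
    {c' : Turing.TM2.Cfg (Prog.Alphabet B) Λ Cell}
    (h : Turing.TM2.stepAux (M l) v S = c') : Steps M 1 ⟨some l, v, S⟩ c' := by
  subst h
  rfl

/-- Induction on the run. The exit label varies: the first half of a sequence leaves to the entry of
the second half, and the body of a loop leaves to the loop head. -/
theorem Runs.steps {p : Prog B} {s s' : Store B} {t : ℕ} (h : Runs p s s' t) {Λ : Type}
    (M : Λ → Turing.TM2.Stmt (Prog.Alphabet B) Λ Cell) (e : p.Label → Λ) (next : Λ)
    (hM : ∀ l, M (e l) = p.code e next l) :
    Steps M t ⟨some (e p.entry), s.cell, s.stacks⟩ ⟨some next, s'.cell, s'.stacks⟩ := by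
  induction h generalizing next with
  | skip s => exact steps_one (by rw [hM]; rfl)
  | push k f s =>
    refine steps_one ?_
    rw [hM, stacks_mk_update]; rfl
  | pop k s =>
    refine steps_one ?_
    rw [hM, stacks_mk_update]; rfl
  | popInput s =>
    refine steps_one ?_
    have h := stacks_mk_inp s s.inp.head? s.inp.tail
    rw [hM, h]; rfl
  | @seq p q s s' s'' a b _ _ ihp ihq =>
    exact (ihp (e ∘ Sum.inl) (e (Sum.inr q.entry)) fun l => hM (Sum.inl l)).trans
      (ihq (e ∘ Sum.inr) next fun l => hM (Sum.inr l))
  | @ite_true f p q s s' a hf _ ih =>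
    refine Steps.trans (steps_one ?_)
      (ih (fun l => e (some (Sum.inl l))) next fun l => hM (some (Sum.inl l)))
    rw [hM]; simp [Prog.entry, Prog.code, hf]
  | @ite_false f p q s s' a hf _ ih =>
    refine Steps.trans (steps_one ?_)
      (ih (fun l => e (some (Sum.inr l))) next fun l => hM (some (Sum.inr l)))
    rw [hM]; simp [Prog.entry, Prog.code, hf]
  | @loop_done f p s hf =>
    refine steps_one ?_
    rw [hM]; simp [Prog.entry, Prog.code, hf]
  | @loop_step f p s s' s'' a b hf _ _ ihp ihl =>
    refine Steps.trans (steps_one ?_)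
      ((ihp (fun l => e (some l)) (e none) fun l => hM (some l)).trans (ihl e next hM))
    rw [hM]; simp [Prog.entry, Prog.code, hf]

/-- The machine that runs the program `p` and halts. -/
def machine [Fintype B] (out : B) (p : Prog B) : Turing.FinTM2 :=
  letI := p.fintypeLabel
  { K := Option B
    k₀ := none
    k₁ := some out
    Γ := Prog.Alphabet B
    Λ := Option p.Label
    main := some p.entry
    σ := Cell
    initialState := none
    Γk₀Fin := inferInstanceAs (Fintype (Option Bool))
    m := fun l => match l with
      | none => .halt
      | some l => p.code some none l }

/-- A program that turns the encoding of `a` into the encoding of `f a` in polynomial time yields a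
machine that does so. -/
theorem nonempty_computableInPolyTime [Fintype B] (out : B) (p : Prog B) {α β : Type}
    (ea : α → List (Option Bool)) (eb : β → List Bool) (f : α → β) (P : Polynomial ℕ)
    (h : ∀ a, ∃ t ≤ P.eval (ea a).length, Runs p ⟨none, ea a, fun _ => []⟩
      ⟨none, [], Function.update (fun _ => []) out (eb (f a))⟩ t) :
    Nonempty (Turing.TM2ComputableInPolyTime ea eb f) := by
  choose t ht hr using h
  refine ⟨{ tm := machine out p, inputAlphabet := Equiv.refl _, outputAlphabet := Equiv.refl _,
            time := P + 1, outputsFun := fun a => ⟨⟨t a + 1, ?_⟩, ?_⟩ }⟩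
  · have h1 := (hr a).steps (machine out p).m some none (fun l => rfl)
    -- The extra step, paid for by `P + 1`, executes `halt` at the exit label `none`.
    have h2 : Steps (machine out p).m 1
        ⟨some none, none, Store.stacks ⟨none, [], Function.update (fun _ => []) out (eb (f a))⟩⟩
        ⟨none, none, Store.stacks ⟨none, [], Function.update (fun _ => []) out (eb (f a))⟩⟩ :=
      steps_one rfl
    have h3 := h1.trans h2
    have e1 : Turing.initList (machine out p) (List.map (Equiv.refl (Option Bool)).invFun (ea a))
        = ⟨some (some p.entry), none, Store.stacks ⟨none, ea a, fun _ => []⟩⟩ := by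
      unfold Turing.initList
      congr 1
      funext k
      rcases k with _ | k
      · exact (dif_pos rfl).trans (List.map_id _)
      · exact dif_neg (Option.some_ne_none k)
    have e2 : Turing.haltList (machine out p) (List.map (Equiv.refl Bool).invFun (eb (f a)))
        = ⟨none, none,
          Store.stacks ⟨none, [], Function.update (fun _ => []) out (eb (f a))⟩⟩ := by
      unfold Turing.haltList
      congr 1
      funext k
      rcases k with _ | k
      · exact dif_neg (Option.some_ne_none out).symm
      · by_cases hk : k = out
        · subst hk
          refine Eq.trans ?_ (Function.update_self k (eb (f a)) (fun _ => [])).symm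
          exact (dif_pos rfl).trans (List.map_id _)
        · refine Eq.trans ?_ (Function.update_of_ne hk (eb (f a)) (fun _ => [])).symm
          exact dif_neg fun e => hk (Option.some.inj e)
    refine Eq.trans ?_ (Eq.trans h3 ?_)
    · exact congrArg (fun c => (flip bind (Turing.TM2.step (machine out p).m))^[t a + 1] (some c))
        e1
    · exact congrArg some e2.symm
  · simpa using ht a

end StackProgram

/-! ### Stack programs on empty input: loops, copying, unary addition, seeking -/

namespace StackProgram

variable {B : Type} [DecidableEq B]

/-- Started with the symbol `v` in the finite memory and with empty input, `p` turns the stacks `S`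
into `S'` within `T` steps. -/
def ExecFrom (v : Cell) (p : Prog B) (S S' : B → List Bool) (T : ℕ) : Prop :=
  ∃ v' t, t ≤ T ∧ Runs p ⟨v, [], S⟩ ⟨v', [], S'⟩ t

/-- With empty input, `p` turns the stacks `S` into `S'` within `T` steps. -/
def Exec (p : Prog B) (S S' : B → List Bool) (T : ℕ) : Prop :=
  ∀ v, ExecFrom v p S S' T

theorem ExecFrom.mono {v : Cell} {p : Prog B} {S S' : B → List Bool} {T T' : ℕ}
    (h : ExecFrom v p S S' T) (hT : T ≤ T') : ExecFrom v p S S' T' := by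
  obtain ⟨v', t, ht, hr⟩ := h
  exact ⟨v', t, ht.trans hT, hr⟩

theorem Exec.mono {p : Prog B} {S S' : B → List Bool} {T T' : ℕ}
    (h : Exec p S S' T) (hT : T ≤ T') : Exec p S S' T' :=
  fun v => (h v).mono hT

theorem exec_skip (S : B → List Bool) : Exec .skip S S 1 :=
  fun v => ⟨v, 1, le_rfl, .skip _⟩

theorem execFrom_push (v : Cell) (k : B) (f : Cell → Bool) (S : B → List Bool) :
    ExecFrom v (.push k f) S (Function.update S k (f v :: S k)) 1 :=
  ⟨v, 1, le_rfl, .push k f ⟨v, [], S⟩⟩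

theorem exec_push (k : B) (b : Bool) (S : B → List Bool) :
    Exec (.push k fun _ => b) S (Function.update S k (b :: S k)) 1 :=
  fun v => execFrom_push v k (fun _ => b) S

theorem exec_pop (k : B) (S : B → List Bool) :
    Exec (.pop k) S (Function.update S k (S k).tail) 1 :=
  fun v => ⟨_, 1, le_rfl, .pop k ⟨v, [], S⟩⟩

theorem ExecFrom.seq {v : Cell} {p q : Prog B} {S S' S'' : B → List Bool} {a b : ℕ}
    (hp : ExecFrom v p S S' a) (hq : Exec q S' S'' b) : ExecFrom v (.seq p q) S S'' (a + b) := by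
  obtain ⟨v', t, ht, hr⟩ := hp
  obtain ⟨v'', t', ht', hr'⟩ := hq v'
  exact ⟨v'', t + t', Nat.add_le_add ht ht', hr.seq hr'⟩

theorem Exec.seq {p q : Prog B} {S S' S'' : B → List Bool} {a b : ℕ}
    (hp : Exec p S S' a) (hq : Exec q S' S'' b) : Exec (.seq p q) S S'' (a + b) :=
  fun v => (hp v).seq hq

/-- Pop the stack `k` and branch on the result. -/
def popIte (k : B) (f : Cell → Bool) (p q : Prog B) : Prog B :=
  .seq (.pop k) (.ite f p q)

theorem exec_popIte_true {k : B} {f : Cell → Bool} {p q : Prog B} {S S' : B → List Bool} {T : ℕ}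
    (hf : f ((S k).head?.map some) = true)
    (h : ExecFrom ((S k).head?.map some) p (Function.update S k (S k).tail) S' T) :
    Exec (popIte k f p q) S S' (T + 2) := by
  intro v
  obtain ⟨v', t, ht, hr⟩ := h
  exact ⟨v', 1 + (1 + t), by omega, (Runs.pop k ⟨v, [], S⟩).seq (.ite_true hf hr)⟩

theorem exec_popIte_false {k : B} {f : Cell → Bool} {p q : Prog B} {S S' : B → List Bool} {T : ℕ}
    (hf : f ((S k).head?.map some) = false)
    (h : ExecFrom ((S k).head?.map some) q (Function.update S k (S k).tail) S' T) :
    Exec (popIte k f p q) S S' (T + 2) := by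
  intro v
  obtain ⟨v', t, ht, hr⟩ := h
  exact ⟨v', 1 + (1 + t), by omega, (Runs.pop k ⟨v, [], S⟩).seq (.ite_false hf hr)⟩

/-- Pop the stack `k` and run `p`, as long as the symbol popped satisfies `f`. -/
def popWhile (k : B) (f : Cell → Bool) (p : Prog B) : Prog B :=
  .seq (.pop k) (.loop f (.seq p (.pop k)))

theorem exec_popWhile_exit {k : B} {f : Cell → Bool} {p : Prog B} {S : B → List Bool}
    (hf : f ((S k).head?.map some) = false) :
    Exec (popWhile k f p) S (Function.update S k (S k).tail) 2 :=
  fun v => ⟨_, 1 + 1, le_rfl, (Runs.pop k ⟨v, [], S⟩).seq (.loop_done hf)⟩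

/-- One unrolling of the loop. The initial pop in the run of the remaining loop is reused as the pop
at the end of the first iteration, so that run has to be taken apart. -/
theorem exec_popWhile_step {k : B} {f : Cell → Bool} {p : Prog B} {S S' S'' : B → List Bool}
    {T T' : ℕ} {b : Bool} {l : List Bool} (hS : S k = b :: l) (hf : f (some (some b)) = true)
    (hp : ExecFrom (some (some b)) p (Function.update S k l) S' T)
    (hw : Exec (popWhile k f p) S' S'' T') :
    Exec (popWhile k f p) S S'' (T + 2 + T') := by
  intro v
  obtain ⟨v', t, ht, hr⟩ := hp
  obtain ⟨v'', t', ht', hr'⟩ := hw v'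
  cases hr' with
  | @seq _ _ _ s' _ a c h1 h2 =>
    cases h1
    have h0 := Runs.pop k ⟨v, [], S⟩
    simp only [hS, List.head?_cons, Option.map_some, List.tail_cons] at h0
    refine ⟨v'', 1 + (1 + ((t + 1) + c)), by omega, ?_⟩
    exact h0.seq (.loop_step hf (hr.seq (.pop k _)) h2)

/-- The loop rule for unary counters: `F m` is the configuration with `m` iterations to go. -/
theorem exec_popWhile_family {k : B} {f : Cell → Bool} {p : Prog B} {T T' : ℕ}
    (hf : f (some (some true)) = true) (F : ℕ → B → List Bool) {S' : B → List Bool}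
    (h0 : Exec (popWhile k f p) (F 0) S' T') (n : ℕ)
    (hF : ∀ m < n, ∃ l, F (m + 1) k = true :: l ∧
      Exec p (Function.update (F (m + 1)) k l) (F m) T) :
    Exec (popWhile k f p) (F n) S' (n * (T + 2) + T') := by
  induction n with
  | zero => simpa using h0
  | succ n ih =>
    obtain ⟨l, hl, hp⟩ := hF n (Nat.lt_succ_self n)
    refine (exec_popWhile_step hl hf (hp _) (ih fun m hm => hF m (hm.trans n.lt_succ_self))).mono
      (le_of_eq ?_)
    ring

/-- Empty the stack `k`. -/
def clear (k : B) : Prog B := popWhile k Option.isSome .skip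

theorem exec_clear (k : B) (S : B → List Bool) :
    Exec (clear k) S (Function.update S k []) (3 * (S k).length + 2) := by
  induction h : S k generalizing S with
  | nil =>
    have := exec_popWhile_exit (k := k) (f := Option.isSome) (p := .skip) (S := S) (by simp [h])
    simpa [h, clear] using this
  | cons b l ih =>
    have := ih (Function.update S k l) (by simp)
    rw [Function.update_idem] at this
    refine (exec_popWhile_step h rfl (exec_skip _ _) this).mono ?_
    simp only [List.length_cons]; omega

/-- The symbol just popped, as a bit. -/
def bit (v : Cell) : Bool := v == some (some true)

@[simp] theorem bit_some (b : Bool) : bit (some (some b)) = b := by cases b <;> rfl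

@[simp] theorem bit_none : bit none = false := rfl

/-- Move the stack `a` onto the stack `b`, in reversed order. -/
def drain (a b : B) : Prog B := popWhile a Option.isSome (.push b bit)

theorem exec_drain {a b : B} (hab : a ≠ b) (S : B → List Bool) :
    Exec (drain a b) S (Function.update (Function.update S a []) b ((S a).reverse ++ S b))
      (3 * (S a).length + 2) := by
  induction h : S a generalizing S with
  | nil =>
    have := exec_popWhile_exit (k := a) (f := Option.isSome) (p := .push b bit) (S := S)
      (by simp [h])
    have e : Function.update (Function.update S a []) b (([] : List Bool).reverse ++ S b)
        = Function.update S a (S a).tail := by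
      have : S b = Function.update S a [] b := (Function.update_of_ne hab.symm _ _).symm
      rw [List.reverse_nil, List.nil_append, this, Function.update_eq_self, h, List.tail_nil]
    rw [e]
    exact this
  | cons c l ih =>
    have h1 := execFrom_push (some (some c)) b bit (Function.update S a l)
    rw [bit_some] at h1
    have h2 := ih (Function.update (Function.update S a l) b (c :: Function.update S a l b))
      (by rw [Function.update_of_ne hab, Function.update_self])
    refine Exec.mono (T := 1 + 2 + (3 * l.length + 2)) ?_
      (by simp only [List.length_cons]; omega)
    refine exec_popWhile_step h rfl h1 ?_
    unfold drain at h2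
    convert h2 using 1
    funext k
    by_cases hb : k = b
    · subst hb
      simp [Function.update_of_ne hab.symm]
    · by_cases ha : k = a
      · subst ha; simp [hb]
      · simp [ha, hb]

/-- Move the unary number on the stack `a` both to `b` and to `c`. -/
def drainTwo (a b c : B) : Prog B :=
  popWhile a Option.isSome (.seq (.push b fun _ => true) (.push c fun _ => true))

theorem exec_drainTwo {a b c : B} (hab : a ≠ b) (hac : a ≠ c) (hbc : b ≠ c) (S : B → List Bool)
    (n : ℕ) (h : S a = List.replicate n true) :
    Exec (drainTwo a b c) S
      (Function.update (Function.update (Function.update S a []) b (List.replicate n true ++ S b)) c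
        (List.replicate n true ++ S c)) (4 * n + 2) := by
  have key := exec_popWhile_family (k := a) (f := Option.isSome)
    (p := .seq (.push b fun _ => true) (.push c fun _ => true)) (T := 2) (T' := 2) rfl
    (fun m => Function.update (Function.update (Function.update S a (List.replicate m true)) b
      (List.replicate (n - m) true ++ S b)) c (List.replicate (n - m) true ++ S c))
    (S' := (Function.update (Function.update (Function.update S a []) b
      (List.replicate n true ++ S b)) c (List.replicate n true ++ S c))) ?_ n ?_
  · refine Exec.mono ?_ (le_of_eq (by ring : n * (2 + 2) + 2 = 4 * n + 2))
    convert! key using 1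
    funext k
    by_cases hc : k = c
    · subst hc; simp
    · by_cases hb : k = b
      · subst hb; simp [hc]
      · by_cases ha : k = a
        · subst ha; simp [hb, hc, h]
        · simp [ha, hb, hc]
  · have e := exec_popWhile_exit (k := a) (f := Option.isSome)
      (p := .seq (.push b fun _ => true) (.push c fun _ => true))
      (S := Function.update (Function.update (Function.update S a []) b
        (List.replicate n true ++ S b)) c (List.replicate n true ++ S c))
      (by simp [hab, hac])
    simp only [List.replicate_zero, Nat.sub_zero]
    convert e using 1
    rw [Function.update_of_ne hac, Function.update_of_ne hab, Function.update_self, List.tail_nil]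
    funext k
    by_cases ha : k = a
    · subst ha; simp [hab, hac]
    · simp [ha]
  · intro m hm
    refine ⟨List.replicate m true, ?_, ?_⟩
    · simp [hab, hac, List.replicate_succ]
    · convert (exec_push b true _).seq (exec_push c true _) using 1
      have e : n - m = (n - (m + 1)) + 1 := by omega
      funext k
      by_cases hc : k = c
      · subst hc; simp [hac.symm, hbc.symm, e, List.replicate_succ]
      · by_cases hb : k = b
        · subst hb; simp [hc, hab.symm, e, List.replicate_succ]
        · by_cases ha : k = a
          · subst ha; simp [hb, hc]
          · simp [ha, hb, hc]

/-- Add the unary number on the stack `r` to the stack `k`, using the empty stack `t`. -/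
def addTo (t k r : B) : Prog B := .seq (drain r t) (drainTwo t r k)

/-- Draining `r` empties it; the second pass refills it from `t` while feeding `k`, so the summand
survives. -/
theorem exec_addTo {t k r : B} (htk : t ≠ k) (htr : t ≠ r) (hkr : k ≠ r) (S : B → List Bool)
    (n : ℕ) (ht : S t = []) (hr : S r = List.replicate n true) :
    Exec (addTo t k r) S (Function.update S k (List.replicate n true ++ S k)) (7 * n + 4) := by
  have h1 := exec_drain htr.symm S
  have h2 := exec_drainTwo htr htk hkr.symm
    (Function.update (Function.update S r []) t ((S r).reverse ++ S t)) n (by simp [ht, hr])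
  rw [hr, List.length_replicate] at h1
  rw [hr] at h2
  refine Exec.mono (T := 3 * n + 2 + (4 * n + 2)) ?_ (by omega)
  convert! h1.seq h2 using 1
  funext k'
  by_cases h₁ : k' = k
  · subst h₁; simp [htk.symm, hkr]
  · by_cases h₂ : k' = r
    · subst h₂; simp [h₁, htr.symm, hr]
    · by_cases h₃ : k' = t
      · subst h₃; simp [h₁, h₂, ht]
      · simp [h₁, h₂, h₃]

/-- The first `n` symbols of a list, padded with `false`. -/
def padTake (n : ℕ) (l : List Bool) : List Bool :=
  (List.range n).map fun i => l.getD i false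

/-- Write the bit `b` at position `n` of the list `l`, which is padded with `false`. -/
def setAt (l : List Bool) (n : ℕ) (b : Bool) : List Bool :=
  padTake n l ++ b :: l.drop (n + 1)

theorem getD_setAt (l : List Bool) (n : ℕ) (b : Bool) (i : ℕ) :
    (setAt l n b).getD i false = if i = n then b else l.getD i false := by
  have hlen : (padTake n l).length = n := by simp [padTake]
  unfold setAt
  rcases lt_trichotomy i n with h | h | h
  · rw [List.getD_append _ _ _ _ (by omega), if_neg h.ne]
    simp [padTake, List.getD_eq_getElem?_getD, h]
  · rw [List.getD_append_right _ _ _ _ (by omega), if_pos h]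
    simp [hlen, h]
  · rw [List.getD_append_right _ _ _ _ (by omega), if_neg (by omega), hlen]
    obtain ⟨m, rfl⟩ : ∃ m, i = n + 1 + m := ⟨i - (n + 1), by omega⟩
    rw [show n + 1 + m - n = m + 1 by omega]
    simp [List.getD_eq_getElem?_getD, List.getElem?_drop]

theorem length_setAt (l : List Bool) (n : ℕ) (b : Bool) :
    (setAt l n b).length = max l.length (n + 1) := by
  simp [setAt, padTake]
  omega

theorem padTake_succ (n : ℕ) (l : List Bool) :
    padTake (n + 1) l = padTake n l ++ [l.getD n false] := by
  simp [padTake, List.range_succ]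

theorem exec_pop_push (a t : B) (S : B → List Bool) :
    Exec (.seq (.pop a) (.push t bit)) S
      (Function.update (Function.update S a (S a).tail) t
        (bit ((S a).head?.map some) :: Function.update S a (S a).tail t)) 2 :=
  fun v => ⟨_, 2, le_rfl, (Runs.pop a ⟨v, [], S⟩).seq (.push t bit _)⟩

/-- Pop as many symbols from `a` as the unary number on `y` says, and push them onto `t`; the stack
`a` is treated as if it ended with infinitely many symbols `false`. -/
def seekPad (a t y : B) : Prog B :=
  popWhile y Option.isSome (.seq (.pop a) (.push t bit))

/-- Used for writing: popping an empty stack yields `none`, which `bit` turns into `false`, so an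
array that is too short is extended on the way. -/
theorem exec_seekPad {a t y : B} (hat : a ≠ t) (hay : a ≠ y) (hty : t ≠ y) (S : B → List Bool)
    (n : ℕ) (h : S y = List.replicate n true) :
    Exec (seekPad a t y) S
      (Function.update (Function.update (Function.update S y []) a ((S a).drop n)) t
        ((padTake n (S a)).reverse ++ S t)) (4 * n + 2) := by
  have key := exec_popWhile_family (k := y) (f := Option.isSome)
    (p := .seq (.pop a) (.push t bit)) (T := 2) (T' := 2) rfl
    (fun m => Function.update (Function.update (Function.update S y (List.replicate m true)) a
      ((S a).drop (n - m))) t ((padTake (n - m) (S a)).reverse ++ S t))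
    (S' := Function.update (Function.update (Function.update S y []) a ((S a).drop n)) t
        ((padTake n (S a)).reverse ++ S t)) ?_ n ?_
  · refine Exec.mono ?_ (le_of_eq (by ring : n * (2 + 2) + 2 = 4 * n + 2))
    convert! key using 1
    funext k
    by_cases hc : k = t
    · subst hc; simp [padTake]
    · by_cases hb : k = a
      · subst hb; simp [hc]
      · by_cases ha : k = y
        · subst ha; simp [hb, hc, h]
        · simp [ha, hb, hc]
  · have e := exec_popWhile_exit (k := y) (f := Option.isSome) (p := .seq (.pop a) (.push t bit))
      (S := Function.update (Function.update (Function.update S y []) a ((S a).drop n)) t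
        ((padTake n (S a)).reverse ++ S t)) (by simp [hay.symm, hty.symm])
    simp only [List.replicate_zero, Nat.sub_zero]
    convert e using 1
    rw [Function.update_of_ne hty.symm, Function.update_of_ne hay.symm, Function.update_self,
      List.tail_nil]
    funext k
    by_cases ha : k = y
    · subst ha; simp [hay.symm, hty.symm]
    · simp [ha]
  · intro m hm
    refine ⟨List.replicate m true, ?_, ?_⟩
    · simp [hay.symm, hty.symm, List.replicate_succ]
    · convert exec_pop_push a t _ using 1
      have e : n - m = (n - (m + 1)) + 1 := by omega
      funext k
      by_cases hc : k = t
      · subst hc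
        have e2 : ∀ o : Option Bool, bit (o.map some) = o.getD false := by
          rintro (_ | b) <;> simp
        simp [hat, hay, hat.symm, hty, e, padTake_succ, e2, List.getD_eq_getElem?_getD,
          List.head?_drop]
      · by_cases hb : k = a
        · subst hb; simp [hc, hay, e]
        · by_cases ha : k = y
          · subst ha; simp [hb, hc]
          · simp [ha, hb, hc]

/-- Pop as many symbols from `a` as the unary number on `y` says, as long as there are any, and push
them onto `t`. -/
def seek (a t y : B) : Prog B :=
  popWhile y Option.isSome (popIte a Option.isSome (.push t bit) .skip)

/-- Used for reading: nothing is pushed once `a` is exhausted, so a read beyond the end leaves the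
array as it was. -/
theorem exec_seek {a t y : B} (hat : a ≠ t) (hay : a ≠ y) (hty : t ≠ y) (S : B → List Bool)
    (n : ℕ) (h : S y = List.replicate n true) :
    Exec (seek a t y) S
      (Function.update (Function.update (Function.update S y []) a ((S a).drop n)) t
        (((S a).take n).reverse ++ S t)) (5 * n + 2) := by
  have key := exec_popWhile_family (k := y) (f := Option.isSome)
    (p := popIte a Option.isSome (.push t bit) .skip) (T := 3) (T' := 2) rfl
    (fun m => Function.update (Function.update (Function.update S y (List.replicate m true)) a
      ((S a).drop (n - m))) t (((S a).take (n - m)).reverse ++ S t))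
    (S' := Function.update (Function.update (Function.update S y []) a ((S a).drop n)) t
        (((S a).take n).reverse ++ S t)) ?_ n ?_
  · refine Exec.mono ?_ (le_of_eq (by ring : n * (3 + 2) + 2 = 5 * n + 2))
    convert! key using 1
    funext k
    by_cases hc : k = t
    · subst hc; simp
    · by_cases hb : k = a
      · subst hb; simp [hc]
      · by_cases ha : k = y
        · subst ha; simp [hb, hc, h]
        · simp [ha, hb, hc]
  · have e := exec_popWhile_exit (k := y) (f := Option.isSome)
      (p := popIte a Option.isSome (.push t bit) .skip)
      (S := Function.update (Function.update (Function.update S y []) a ((S a).drop n)) t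
        (((S a).take n).reverse ++ S t)) (by simp [hay.symm, hty.symm])
    simp only [List.replicate_zero, Nat.sub_zero]
    convert e using 1
    rw [Function.update_of_ne hty.symm, Function.update_of_ne hay.symm, Function.update_self,
      List.tail_nil]
    funext k
    by_cases ha : k = y
    · subst ha; simp [hay.symm, hty.symm]
    · simp [ha]
  · intro m hm
    refine ⟨List.replicate m true, ?_, ?_⟩
    · simp [hay.symm, hty.symm, List.replicate_succ]
    · have e : n - m = (n - (m + 1)) + 1 := by omega
      generalize n - (m + 1) = j at e
      rw [e]
      rcases hj : (S a)[j]? with _ | b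
      · have hl : (S a).length ≤ j := by simpa using hj
        refine exec_popIte_false (T := 1) (by simp [hat, hay, hl]) ?_
        convert @exec_skip B ‹_› _ _ using 1
        funext k
        by_cases hc : k = t
        · subst hc
          simp [hat.symm, hty, List.take_of_length_le hl,
            List.take_of_length_le (hl.trans (Nat.le_succ _))]
        · by_cases hb : k = a
          · subst hb; simp [hc, hay]
          · by_cases ha : k = y
            · subst ha; simp [hb, hc]
            · simp [ha, hb, hc]
      · have hl : j < (S a).length := by
          by_contra hh
          rw [List.getElem?_eq_none (by omega)] at hj
          cases hj
        have hh : (List.drop j (S a)).head? = some b := by rw [List.head?_drop, hj]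
        refine exec_popIte_true (T := 1) (by simp [hat, hay, hj]) ?_
        convert execFrom_push _ t bit _ using 1
        funext k
        by_cases hc : k = t
        · subst hc
          simp [hat, hay, hat.symm, hty, List.take_add_one, hj]
        · by_cases hb : k = a
          · subst hb; simp [hc, hay]
          · by_cases ha : k = y
            · subst ha; simp [hb, hc]
            · simp [ha, hb, hc]

end StackProgram

namespace StackProgram

/-! ### A language with registers, bit arrays, and bounded loops -/

/-- The registers; `stride` separates the rows of the arrays. -/
inductive Reg : Type
  | order | stride | size | zero | row | col | mid | fst | snd | thr | cnt | rnd
  deriving DecidableEq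

instance : Fintype Reg where
  elems := {.order, .stride, .size, .zero, .row, .col, .mid, .fst, .snd, .thr, .cnt, .rnd}
  complete r := by cases r <;> decide

/-- The arrays. -/
inductive Arr : Type
  | adj | ball | ball' | closer | cov | out | flag
  deriving DecidableEq

instance : Fintype Arr where
  elems := {.adj, .ball, .ball', .closer, .cov, .out, .flag}
  complete a := by cases a <;> decide

/-- The stacks of the compiled programs. -/
inductive Key : Type
  | out | ctl | x | y | t
  | reg : Reg → Key
  | arr : Arr → Key
  deriving DecidableEq, Fintype

/-- Commands. Arrays are addressed by three registers; a loop counts downwards. -/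
inductive Cmd : Type
  | skip : Cmd
  | write : Arr → Reg → Reg → Reg → Bool → Cmd
  | ifRead : Arr → Reg → Reg → Reg → Cmd → Cmd → Cmd
  | ifZero : Reg → Cmd → Cmd → Cmd
  | copy : Reg → Reg → Cmd
  | dec : Reg → Cmd
  | emit : Bool → Cmd
  | seq : Cmd → Cmd → Cmd
  | forDown : Reg → Reg → Cmd → Cmd

/-- The states of the register language. -/
@[ext] structure State : Type where
  reg : Reg → ℕ
  arr : Arr → List Bool
  out : List Bool

namespace State

/-- Assign a register. -/
def setReg (s : State) (r : Reg) (m : ℕ) : State := { s with reg := Function.update s.reg r m }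

/-- Assign an array. -/
def setArr (s : State) (a : Arr) (l : List Bool) : State :=
  { s with arr := Function.update s.arr a l }

/-- The address of an array cell. -/
def addr (s : State) (i j k : Reg) : ℕ :=
  (s.reg i * s.reg .stride + s.reg j) * s.reg .stride + s.reg k

/-- The contents of the stacks of a state, given the contents of the auxiliary stacks. -/
def lay (s : State) (c x y t : List Bool) : Key → List Bool
  | .out => s.out
  | .ctl => c
  | .x => x
  | .y => y
  | .t => t
  | .reg r => List.replicate (s.reg r) true
  | .arr a => s.arr a

/-- All registers are bounded by `M` and the lengths of all arrays by `(M + 1) ^ 3`. -/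
def Bounded (M : ℕ) (s : State) : Prop :=
  (∀ r, s.reg r ≤ M) ∧ ∀ a, (s.arr a).length ≤ (M + 1) ^ 3

end State

/-- Apply `f (n - 1)`, …, `f 0` in this order. -/
def descend {α : Type*} : ℕ → (ℕ → α → α) → α → α
  | 0, _, x => x
  | n + 1, f, x => descend n f (f n x)

/-- The meaning of a command. -/
def Cmd.eval : Cmd → State → State
  | .skip, s => s
  | .write a i j k b, s => s.setArr a (setAt (s.arr a) (s.addr i j k) b)
  | .ifRead a i j k p q, s =>
      if (s.arr a).getD (s.addr i j k) false = true then p.eval s else q.eval s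
  | .ifZero r p q, s => if s.reg r = 0 then p.eval s else q.eval s
  | .copy v w, s => s.setReg v (s.reg w)
  | .dec v, s => s.setReg v (s.reg v - 1)
  | .emit b, s => { s with out := b :: s.out }
  | .seq p q, s => q.eval (p.eval s)
  | .forDown v w p, s => descend (s.reg w) (fun m s => p.eval (s.setReg v m)) s

/-! ### Compilation to stack programs -/

/-- Compute the address of an array cell on the stack `y`. -/
def addrProg (i j k : Reg) : Prog Key :=
  .seq (addTo .t .y (.reg i)) (.seq (popWhile .y Option.isSome (addTo .t .x (.reg .stride)))
    (.seq (addTo .t .x (.reg j)) (.seq (popWhile .x Option.isSome (addTo .t .y (.reg .stride)))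
      (addTo .t .y (.reg k)))))

/-- Copy the unary number on top of the control stack to the register `v`. -/
def loadCounter (v : Reg) : Prog Key :=
  .seq (clear (.reg v)) (.seq (popWhile .ctl bit (.push .t fun _ => true))
    (.seq (.push .ctl fun _ => false) (drainTwo .t .ctl (.reg v))))

/-- The stack program of a command. -/
def Cmd.compile : Cmd → Prog Key
  | .skip => .skip
  | .write a i j k b =>
      .seq (addrProg i j k) (.seq (seekPad (.arr a) .t .y) (.seq (.pop (.arr a))
        (.seq (.push (.arr a) fun _ => b) (drain .t (.arr a)))))
  | .ifRead a i j k p q =>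
      .seq (addrProg i j k) (.seq (seek (.arr a) .t .y) (popIte (.arr a) bit
        (.seq (.push (.arr a) fun _ => true) (.seq (drain .t (.arr a)) p.compile))
        (.seq (.ite Option.isSome (.push (.arr a) fun _ => false) .skip)
          (.seq (drain .t (.arr a)) q.compile))))
  | .ifZero r p q =>
      popIte (.reg r) Option.isSome (.seq (.push (.reg r) fun _ => true) q.compile) p.compile
  | .copy v w => .seq (addTo .t .x (.reg w)) (.seq (clear (.reg v)) (drain .x (.reg v)))
  | .dec v => .pop (.reg v)
  | .emit b => .push .out fun _ => b
  | .seq p q => .seq p.compile q.compile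
  | .forDown v w p =>
      .seq (.push .ctl fun _ => false) (.seq (addTo .t .ctl (.reg w))
        (popWhile .ctl bit (.seq (loadCounter v) p.compile)))

/-! ### Stack contents of a register state -/

section lay

variable (s : State) (c x y t l : List Bool)

@[simp] theorem lay_ctl : s.lay c x y t .ctl = c := rfl
@[simp] theorem lay_x : s.lay c x y t .x = x := rfl
@[simp] theorem lay_y : s.lay c x y t .y = y := rfl
@[simp] theorem lay_t : s.lay c x y t .t = t := rfl
@[simp] theorem lay_out : s.lay c x y t .out = s.out := rfl
@[simp] theorem lay_reg (r : Reg) : s.lay c x y t (.reg r) = List.replicate (s.reg r) true := rfl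
@[simp] theorem lay_arr (a : Arr) : s.lay c x y t (.arr a) = s.arr a := rfl

@[simp] theorem update_lay_ctl :
    Function.update (s.lay c x y t) .ctl l = s.lay l x y t := by
  funext k; cases k <;> simp [Function.update]

@[simp] theorem update_lay_x :
    Function.update (s.lay c x y t) .x l = s.lay c l y t := by
  funext k; cases k <;> simp [Function.update]

@[simp] theorem update_lay_y :
    Function.update (s.lay c x y t) .y l = s.lay c x l t := by
  funext k; cases k <;> simp [Function.update]

@[simp] theorem update_lay_t :
    Function.update (s.lay c x y t) .t l = s.lay c x y l := by
  funext k; cases k <;> simp [Function.update]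

@[simp] theorem update_lay_arr (a : Arr) :
    Function.update (s.lay c x y t) (.arr a) l = (s.setArr a l).lay c x y t := by
  funext k
  rcases k with _ | _ | _ | _ | _ | r | a' <;> simp [Function.update, State.setArr]

@[simp] theorem update_lay_reg (r : Reg) (m : ℕ) :
    Function.update (s.lay c x y t) (.reg r) (List.replicate m true)
      = (s.setReg r m).lay c x y t := by
  funext k
  rcases k with _ | _ | _ | _ | _ | r' | a <;> try simp [Function.update, State.setReg]
  by_cases h : r' = r
  · subst h; simp
  · simp [h]

@[simp] theorem update_lay_reg_nil (r : Reg) :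
    Function.update (s.lay c x y t) (.reg r) [] = (s.setReg r 0).lay c x y t :=
  update_lay_reg s c x y t r 0

@[simp] theorem update_lay_out (o : List Bool) :
    Function.update (s.lay c x y t) .out o = ({ s with out := o } : State).lay c x y t := by
  funext k; cases k <;> simp [Function.update]

end lay

/-! ### Updates and size bounds of states -/

namespace State

@[simp] theorem setArr_setArr (s : State) (a : Arr) (l l' : List Bool) :
    (s.setArr a l).setArr a l' = s.setArr a l' := by simp [setArr]

@[simp] theorem setReg_setReg (s : State) (r : Reg) (m m' : ℕ) :
    (s.setReg r m).setReg r m' = s.setReg r m' := by simp [setReg]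

@[simp] theorem setArr_self (s : State) (a : Arr) : s.setArr a (s.arr a) = s := by simp [setArr]

@[simp] theorem setReg_self (s : State) (r : Reg) : s.setReg r (s.reg r) = s := by simp [setReg]

@[simp] theorem setArr_arr_self (s : State) (a : Arr) (l : List Bool) :
    (s.setArr a l).arr a = l := by simp [setArr]

@[simp] theorem setReg_reg_self (s : State) (r : Reg) (m : ℕ) :
    (s.setReg r m).reg r = m := by simp [setReg]

theorem setReg_reg (s : State) (r r' : Reg) (m : ℕ) :
    (s.setReg r m).reg r' = if r' = r then m else s.reg r' := by
  simp [setReg, Function.update_apply]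

theorem setArr_arr (s : State) (a a' : Arr) (l : List Bool) :
    (s.setArr a l).arr a' = if a' = a then l else s.arr a' := by
  simp [setArr, Function.update_apply]

@[simp] theorem setReg_arr (s : State) (r : Reg) (m : ℕ) : (s.setReg r m).arr = s.arr := rfl

@[simp] theorem setArr_reg (s : State) (a : Arr) (l : List Bool) :
    (s.setArr a l).reg = s.reg := rfl

@[simp] theorem setReg_out (s : State) (r : Reg) (m : ℕ) : (s.setReg r m).out = s.out := rfl

@[simp] theorem setArr_out (s : State) (a : Arr) (l : List Bool) :
    (s.setArr a l).out = s.out := rfl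

variable {M : ℕ} {s : State}

theorem Bounded.addr_le (h : s.Bounded M) (i j k : Reg) :
    s.addr i j k ≤ (M * M + M) * M + M := by
  have := h.1
  unfold addr
  gcongr <;> exact this _

theorem Bounded.setReg (h : s.Bounded M) (r : Reg) {m : ℕ} (hm : m ≤ M) :
    (s.setReg r m).Bounded M := by
  refine ⟨fun r' => ?_, h.2⟩
  rw [setReg_reg]
  split
  · exact hm
  · exact h.1 r'

end State

theorem descend_induction {α : Type*} {P : α → Prop} {f : ℕ → α → α} {n : ℕ}
    (hf : ∀ m < n, ∀ x, P x → P (f m x)) {x : α} (hx : P x) : P (descend n f x) := by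
  induction n generalizing x with
  | zero => exact hx
  | succ n ih =>
    exact ih (fun m hm => hf m (hm.trans n.lt_succ_self)) (hf n n.lt_succ_self x hx)

/-- Registers are only copied, decremented, or used as loop counters below another register, so one
bound `M` serves a whole computation. This is what makes a fixed cost polynomial per command
possible. -/
theorem State.Bounded.eval {M : ℕ} (c : Cmd) {s : State} (h : s.Bounded M) :
    (c.eval s).Bounded M := by
  induction c generalizing s with
  | skip => exact h
  | write a i j k b =>
    refine ⟨h.1, fun a' => ?_⟩
    simp only [Cmd.eval, State.setArr_arr]
    split
    · rw [length_setAt]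
      -- A write makes the length at most `(M * M + M) * M + M + 1`, which does not exceed `(M + 1)
      -- ^ 3`.
      have := h.addr_le i j k
      refine max_le (h.2 a) ?_
      nlinarith [Nat.zero_le (M * M), Nat.zero_le M]
    · exact h.2 a'
  | ifRead a i j k p q ihp ihq =>
    simp only [Cmd.eval]
    split
    exacts [ihp h, ihq h]
  | ifZero r p q ihp ihq =>
    simp only [Cmd.eval]
    split
    exacts [ihp h, ihq h]
  | copy v w => exact h.setReg v (h.1 w)
  | dec v => exact h.setReg v ((Nat.sub_le _ _).trans (h.1 v))
  | emit b => exact h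
  | seq p q ihp ihq => exact ihq (ihp h)
  | forDown v w p ih =>
    exact descend_induction (P := State.Bounded M)
      (fun m hm x hx => ih (hx.setReg v (hm.le.trans (h.1 w)))) h

open Polynomial in
/-- A bound for the addresses of array cells. -/
noncomputable def addrPoly : ℕ[X] := (X * X + X) * X + X

open Polynomial in
/-- A bound for the time that the computation of an address takes. -/
noncomputable def addrCost : ℕ[X] :=
  (7 * X + 4) + ((X * ((7 * X + 4) + 2) + 2) + ((7 * X + 4) + (((X * X + X) * ((7 * X + 4) + 2) + 2)
    + (7 * X + 4))))

open Polynomial in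
/-- A bound for the running time of a compiled command in terms of the size of the numbers. -/
noncomputable def Cmd.cost : Cmd → ℕ[X]
  | .skip => 1
  | .write _ _ _ _ _ => addrCost + ((4 * addrPoly + 2) + (1 + (1 + (3 * addrPoly + 2))))
  | .ifRead _ _ _ _ p q =>
      addrCost + ((5 * addrPoly + 2) + ((2 + ((3 * addrPoly + 2) + (p.cost + q.cost))) + 2))
  | .ifZero _ p q => (1 + (p.cost + q.cost)) + 2
  | .copy _ _ => (7 * X + 4) + ((3 * X + 2) + (3 * X + 2))
  | .dec _ => 1
  | .emit _ => 1
  | .seq p q => p.cost + q.cost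
  | .forDown _ _ p => 1 + ((7 * X + 4) +
      (X * ((((3 * X + 2) + ((3 * X + 2) + (1 + (4 * X + 2)))) + p.cost) + 2) + 2))

/-! ### Correctness and cost of compiled commands -/

section compile

variable {M : ℕ} {s : State}

theorem exec_addTo_x (s : State) (c y : List Bool) (m : ℕ) (r : Reg) :
    Exec (addTo .t .x (.reg r)) (s.lay c (List.replicate m true) y [])
      (s.lay c (List.replicate (m + s.reg r) true) y []) (7 * s.reg r + 4) := by
  have := exec_addTo (t := Key.t) (k := .x) (r := .reg r) (by simp) (by simp) (by simp)
    (s.lay c (List.replicate m true) y []) (s.reg r) rfl rfl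
  simpa [Nat.add_comm] using this

theorem exec_addTo_y (s : State) (c x : List Bool) (m : ℕ) (r : Reg) :
    Exec (addTo .t .y (.reg r)) (s.lay c x (List.replicate m true) [])
      (s.lay c x (List.replicate (m + s.reg r) true) []) (7 * s.reg r + 4) := by
  have := exec_addTo (t := Key.t) (k := .y) (r := .reg r) (by simp) (by simp) (by simp)
    (s.lay c x (List.replicate m true) []) (s.reg r) rfl rfl
  simpa [Nat.add_comm] using this

theorem exec_mul_x (s : State) (c : List Bool) (m : ℕ) (r : Reg) :
    Exec (popWhile .y Option.isSome (addTo .t .x (.reg r))) (s.lay c [] (List.replicate m true) [])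
      (s.lay c (List.replicate (m * s.reg r) true) [] [])
      (m * ((7 * s.reg r + 4) + 2) + 2) := by
  have := exec_popWhile_family (k := Key.y) (f := Option.isSome) (p := addTo .t .x (.reg r))
    (T := 7 * s.reg r + 4) (T' := 2) rfl
    (fun k => s.lay c (List.replicate ((m - k) * s.reg r) true) (List.replicate k true) [])
    (S' := s.lay c (List.replicate (m * s.reg r) true) [] []) ?_ m ?_
  · simpa using this
  · simpa using exec_popWhile_exit (k := Key.y) (f := Option.isSome) (p := addTo .t .x (.reg r))
      (S := s.lay c (List.replicate (m * s.reg r) true) [] []) rfl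
  · intro k hk
    refine ⟨List.replicate k true, by simp [List.replicate_succ], ?_⟩
    have e : (m - k) * s.reg r = (m - (k + 1)) * s.reg r + s.reg r := by
      rw [← Nat.succ_mul]; congr 1; omega
    rw [update_lay_y, e]
    exact exec_addTo_x s c _ _ r

theorem exec_mul_y (s : State) (c : List Bool) (m : ℕ) (r : Reg) :
    Exec (popWhile .x Option.isSome (addTo .t .y (.reg r))) (s.lay c (List.replicate m true) [] [])
      (s.lay c [] (List.replicate (m * s.reg r) true) [])
      (m * ((7 * s.reg r + 4) + 2) + 2) := by
  have := exec_popWhile_family (k := Key.x) (f := Option.isSome) (p := addTo .t .y (.reg r))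
    (T := 7 * s.reg r + 4) (T' := 2) rfl
    (fun k => s.lay c (List.replicate k true) (List.replicate ((m - k) * s.reg r) true) [])
    (S' := s.lay c [] (List.replicate (m * s.reg r) true) []) ?_ m ?_
  · simpa using this
  · simpa using exec_popWhile_exit (k := Key.x) (f := Option.isSome) (p := addTo .t .y (.reg r))
      (S := s.lay c [] (List.replicate (m * s.reg r) true) []) rfl
  · intro k hk
    refine ⟨List.replicate k true, by simp [List.replicate_succ], ?_⟩
    have e : (m - k) * s.reg r = (m - (k + 1)) * s.reg r + s.reg r := by
      rw [← Nat.succ_mul]; congr 1; omega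
    rw [update_lay_x, e]
    exact exec_addTo_y s c _ _ r

/-- Horner's scheme: `y` receives `i`, `x` receives `i * stride + j`, and `y` then receives `x *
stride + k`; each multiplication consumes its source stack. -/
theorem exec_addrProg (h : s.Bounded M) (c : List Bool) (i j k : Reg) :
    Exec (addrProg i j k) (s.lay c [] [] [])
      (s.lay c [] (List.replicate (s.addr i j k) true) []) (addrCost.eval M) := by
  have h1 := exec_addTo_y s c [] 0 i
  have h2 := exec_mul_x s c (0 + s.reg i) .stride
  have h3 := exec_addTo_x s c [] ((0 + s.reg i) * s.reg .stride) j
  have h4 := exec_mul_y s c ((0 + s.reg i) * s.reg .stride + s.reg j) .stride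
  have h5 := exec_addTo_y s c [] (((0 + s.reg i) * s.reg .stride + s.reg j) * s.reg .stride) k
  have h6 := h1.seq (h2.seq (h3.seq (h4.seq h5)))
  rw [Nat.zero_add] at h6
  refine Exec.mono h6 ?_
  · simp only [addrCost, Polynomial.eval_add, Polynomial.eval_mul, Polynomial.eval_X,
      Polynomial.eval_ofNat]
    have := h.1
    gcongr <;> exact this _

theorem Bounded_addr_le_eval (h : s.Bounded M) (i j k : Reg) :
    s.addr i j k ≤ addrPoly.eval M := by
  simpa [addrPoly] using h.addr_le i j k

theorem exec_write (h : s.Bounded M) (c : List Bool) (a : Arr) (i j k : Reg) (b : Bool) :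
    Exec (Cmd.write a i j k b).compile (s.lay c [] [] [])
      (((Cmd.write a i j k b).eval s).lay c [] [] []) ((Cmd.write a i j k b).cost.eval M) := by
  have h1 := exec_addrProg h c i j k
  have h2 := exec_seekPad (a := Key.arr a) (t := .t) (y := .y) (by simp) (by simp) (by simp)
    (s.lay c [] (List.replicate (s.addr i j k) true) []) (s.addr i j k) rfl
  simp only [update_lay_y, update_lay_arr, update_lay_t, lay_arr, lay_t, List.append_nil] at h2
  have h3 := exec_pop (Key.arr a)
    ((s.setArr a ((s.arr a).drop (s.addr i j k))).lay c [] []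
      (padTake (s.addr i j k) (s.arr a)).reverse)
  simp only [update_lay_arr, lay_arr, State.setArr_arr_self, State.setArr_setArr,
    List.tail_drop] at h3
  have h4 := exec_push (Key.arr a) b ((s.setArr a ((s.arr a).drop (s.addr i j k + 1))).lay c [] []
      (padTake (s.addr i j k) (s.arr a)).reverse)
  simp only [update_lay_arr, lay_arr, State.setArr_arr_self, State.setArr_setArr] at h4
  have h5 := exec_drain (a := Key.t) (b := .arr a) (by simp)
    ((s.setArr a (b :: (s.arr a).drop (s.addr i j k + 1))).lay c [] []
      (padTake (s.addr i j k) (s.arr a)).reverse)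
  simp only [update_lay_arr, update_lay_t, lay_arr, lay_t, State.setArr_arr_self,
    State.setArr_setArr, List.reverse_reverse, List.length_reverse] at h5
  refine (h1.seq (h2.seq (h3.seq (h4.seq h5)))).mono ?_
  have e : (padTake (s.addr i j k) (s.arr a)).length = s.addr i j k := by simp [padTake]
  rw [e]
  simp only [Cmd.cost, Polynomial.eval_add, Polynomial.eval_mul, Polynomial.eval_one,
      Polynomial.eval_ofNat]
  gcongr <;> exact Bounded_addr_le_eval h i j k

theorem exec_ifRead (h : s.Bounded M) (c : List Bool) (a : Arr) (i j k : Reg) (p q : Cmd)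
    (hp : Exec p.compile (s.lay c [] [] []) ((p.eval s).lay c [] [] []) (p.cost.eval M))
    (hq : Exec q.compile (s.lay c [] [] []) ((q.eval s).lay c [] [] []) (q.cost.eval M)) :
    Exec (Cmd.ifRead a i j k p q).compile (s.lay c [] [] [])
      (((Cmd.ifRead a i j k p q).eval s).lay c [] [] [])
      ((Cmd.ifRead a i j k p q).cost.eval M) := by
  have hN := Bounded_addr_le_eval h i j k
  have h1 := exec_addrProg h c i j k
  have h2 := exec_seek (a := Key.arr a) (t := .t) (y := .y) (by simp) (by simp) (by simp)
    (s.lay c [] (List.replicate (s.addr i j k) true) []) (s.addr i j k) rfl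
  simp only [update_lay_y, update_lay_arr, update_lay_t, lay_arr, lay_t, List.append_nil] at h2
  have hlen : (List.take (s.addr i j k) (s.arr a)).length ≤ addrPoly.eval M :=
    (List.length_take_le _ _).trans hN
  -- The prefix set aside on `t` is put back before either branch starts, so both see the original
  -- state.
  have restore : Exec (drain .t (.arr a)) ((s.setArr a ((s.arr a).drop (s.addr i j k))).lay c [] []
      (List.take (s.addr i j k) (s.arr a)).reverse) (s.lay c [] [] [])
      (3 * addrPoly.eval M + 2) := by
    have := exec_drain (a := Key.t) (b := .arr a) (by simp)
      ((s.setArr a ((s.arr a).drop (s.addr i j k))).lay c [] []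
        (List.take (s.addr i j k) (s.arr a)).reverse)
    simp only [update_lay_arr, update_lay_t, lay_arr, lay_t, State.setArr_arr_self,
      State.setArr_setArr, List.reverse_reverse, List.length_reverse, List.take_append_drop,
      State.setArr_self] at this
    refine this.mono ?_
    gcongr
  have key : Exec (popIte (.arr a) bit
        (.seq (.push (.arr a) fun _ => true) (.seq (drain .t (.arr a)) p.compile))
        (.seq (.ite Option.isSome (.push (.arr a) fun _ => false) .skip)
          (.seq (drain .t (.arr a)) q.compile)))
      ((s.setArr a ((s.arr a).drop (s.addr i j k))).lay c [] []
        (List.take (s.addr i j k) (s.arr a)).reverse)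
      (((Cmd.ifRead a i j k p q).eval s).lay c [] [] [])
      ((2 + ((3 * addrPoly.eval M + 2) + (p.cost.eval M + q.cost.eval M))) + 2) := by
    have hhead : (List.drop (s.addr i j k) (s.arr a)).head? = (s.arr a)[s.addr i j k]? := by
      simp
    rcases hj : (s.arr a)[s.addr i j k]? with _ | b
    · have hl : (s.arr a).length ≤ s.addr i j k := by simpa using hj
      refine exec_popIte_false (by simp [hj]) ?_
      have hd : List.drop (s.addr i j k) (s.arr a) = [] := List.drop_eq_nil_of_le hl
      have he : (Cmd.ifRead a i j k p q).eval s = q.eval s := by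
        simp [Cmd.eval, List.getD_eq_getElem?_getD, hj]
      rw [hd] at restore
      rw [he, hd]
      simp only [lay_arr, State.setArr_arr_self, List.head?_nil, Option.map_none, List.tail_nil,
        update_lay_arr, State.setArr_setArr]
      refine ExecFrom.mono (ExecFrom.seq (a := 2) ?_ (restore.seq hq)) (by omega)
      -- Beyond the end of the array nothing was popped, so nothing may be pushed back; a popped
      -- `false` has to be.
      exact ⟨_, _, le_rfl, .ite_false rfl (.skip _)⟩
    · have hd : List.drop (s.addr i j k) (s.arr a)
          = b :: List.drop (s.addr i j k + 1) (s.arr a) := by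
        rw [hj] at hhead
        rw [← List.tail_drop]
        exact (List.cons_head?_tail hhead).symm
      have he : (Cmd.ifRead a i j k p q).eval s = if b = true then p.eval s else q.eval s := by
        simp [Cmd.eval, List.getD_eq_getElem?_getD, hj]
      rw [hd] at restore
      rw [he, hd]
      cases b with
      | true =>
        refine exec_popIte_true (by simp) ?_
        simp only [lay_arr, State.setArr_arr_self, List.head?_cons, Option.map_some,
          List.tail_cons, update_lay_arr, State.setArr_setArr]
        have h3 := execFrom_push (some (some true)) (Key.arr a) (fun _ => true)
          ((s.setArr a ((s.arr a).drop (s.addr i j k + 1))).lay c [] []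
            (List.take (s.addr i j k) (s.arr a)).reverse)
        simp only [update_lay_arr, lay_arr, State.setArr_arr_self, State.setArr_setArr] at h3
        exact (h3.seq (restore.seq hp)).mono (by omega)
      | false =>
        refine exec_popIte_false (by simp) ?_
        simp only [lay_arr, State.setArr_arr_self, List.head?_cons, Option.map_some,
          List.tail_cons, update_lay_arr, State.setArr_setArr]
        refine ExecFrom.mono (ExecFrom.seq (a := 2) ?_ (restore.seq hq)) (by omega)
        have h3 := Runs.push (Key.arr a) (fun _ => false) ⟨some (some false), [],
          ((s.setArr a ((s.arr a).drop (s.addr i j k + 1))).lay c [] []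
            (List.take (s.addr i j k) (s.arr a)).reverse)⟩
        simp only [update_lay_arr, lay_arr, State.setArr_arr_self, State.setArr_setArr] at h3
        exact ⟨_, _, le_rfl, .ite_true rfl h3⟩
  refine (h1.seq (h2.seq key)).mono ?_
  simp only [Cmd.cost, Polynomial.eval_add, Polynomial.eval_mul, Polynomial.eval_ofNat]
  gcongr

theorem exec_copy (h : s.Bounded M) (c : List Bool) (v w : Reg) :
    Exec (Cmd.copy v w).compile (s.lay c [] [] [])
      (((Cmd.copy v w).eval s).lay c [] [] []) ((Cmd.copy v w).cost.eval M) := by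
  have h1 := exec_addTo_x s c [] 0 w
  have h2 := exec_clear (Key.reg v) (s.lay c (List.replicate (0 + s.reg w) true) [] [])
  have h3 := exec_drain (a := Key.x) (b := .reg v) (by simp)
    ((s.setReg v 0).lay c (List.replicate (0 + s.reg w) true) [] [])
  simp only [update_lay_reg_nil, lay_reg, List.length_replicate] at h2
  simp only [update_lay_x, lay_x, lay_reg, List.length_replicate, State.setReg_reg_self,
    List.replicate_zero, List.append_nil, List.reverse_replicate, update_lay_reg,
    State.setReg_setReg] at h3
  have h4 := h1.seq (h2.seq h3)
  rw [Nat.zero_add] at h4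
  refine Exec.mono h4 ?_
  · simp only [Cmd.cost, Polynomial.eval_add, Polynomial.eval_mul, Polynomial.eval_X,
      Polynomial.eval_ofNat]
    have := h.1
    gcongr <;> exact this _

/-- The counters of nested loops share the control stack, separated by `false`. Reading off the top
counter consumes its separator, which is pushed again before the counter is copied back. -/
theorem exec_loadCounter (h : s.Bounded M) (rest : List Bool) (v : Reg) {m : ℕ} (hm : m ≤ M) :
    Exec (loadCounter v) (s.lay (List.replicate m true ++ false :: rest) [] [] [])
      ((s.setReg v m).lay (List.replicate m true ++ false :: rest) [] [] [])
      ((3 * M + 2) + ((3 * M + 2) + (1 + (4 * M + 2)))) := by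
  have h1 := exec_clear (Key.reg v) (s.lay (List.replicate m true ++ false :: rest) [] [] [])
  simp only [update_lay_reg_nil, lay_reg, List.length_replicate] at h1
  have h2 : Exec (popWhile .ctl bit (.push .t fun _ => true))
      ((s.setReg v 0).lay (List.replicate m true ++ false :: rest) [] [] [])
      ((s.setReg v 0).lay rest [] [] (List.replicate m true)) (m * (1 + 2) + 2) := by
    have := exec_popWhile_family (k := Key.ctl) (f := bit) (p := .push .t fun _ => true)
      (T := 1) (T' := 2) rfl
      (fun k => (s.setReg v 0).lay (List.replicate k true ++ false :: rest) [] []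
        (List.replicate (m - k) true))
      (S' := (s.setReg v 0).lay rest [] [] (List.replicate m true)) ?_ m ?_
    · simpa using this
    · simpa using exec_popWhile_exit (k := Key.ctl) (f := bit) (p := .push .t fun _ => true)
        (S := (s.setReg v 0).lay (false :: rest) [] [] (List.replicate m true)) rfl
    · intro k hk
      refine ⟨List.replicate k true ++ false :: rest, by simp [List.replicate_succ], ?_⟩
      have e : m - k = (m - (k + 1)) + 1 := by omega
      have := exec_push Key.t true ((s.setReg v 0).lay (List.replicate k true ++ false :: rest)
        [] [] (List.replicate (m - (k + 1)) true))
      rw [update_lay_ctl, e]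
      simpa [List.replicate_succ] using this
  have h3 := exec_push Key.ctl false ((s.setReg v 0).lay rest [] [] (List.replicate m true))
  simp only [update_lay_ctl, lay_ctl] at h3
  have h4 := exec_drainTwo (a := Key.t) (b := .ctl) (c := .reg v) (by simp) (by simp) (by simp)
    ((s.setReg v 0).lay (false :: rest) [] [] (List.replicate m true)) m rfl
  simp only [update_lay_t, update_lay_ctl, lay_ctl, lay_reg, State.setReg_reg_self,
    List.replicate_zero, List.append_nil, update_lay_reg, State.setReg_setReg] at h4
  refine (h1.seq (h2.seq (h3.seq h4))).mono ?_
  have := h.1 v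
  omega

/-- Induction on the command, with arbitrary contents `c` of the control stack, because the body of
a loop runs above the counters of the enclosing loops. -/
theorem Cmd.exec_compile (p : Cmd) (h : s.Bounded M) (c : List Bool) :
    Exec p.compile (s.lay c [] [] []) ((p.eval s).lay c [] [] []) (p.cost.eval M) := by
  induction p generalizing s c with
  | skip => exact (exec_skip _).mono (by simp [Cmd.cost])
  | write a i j k b => exact exec_write h c a i j k b
  | ifRead a i j k p q ihp ihq => exact exec_ifRead h c a i j k p q (ihp h c) (ihq h c)
  | ifZero r p q ihp ihq =>
    rcases hr : s.reg r with _ | m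
    · refine (exec_popIte_false (T := p.cost.eval M) (by simp [hr]) ?_).mono ?_
      · have e : (Cmd.ifZero r p q).eval s = p.eval s := by simp [Cmd.eval, hr]
        have e' : s.setReg r 0 = s := by rw [← hr, State.setReg_self]
        simp only [lay_reg, hr, List.replicate_zero, List.tail_nil, update_lay_reg_nil, e, e']
        exact ihp h c _
      · simp only [Cmd.cost, Polynomial.eval_add, Polynomial.eval_one, Polynomial.eval_ofNat]
        omega
    · refine (exec_popIte_true (T := 1 + q.cost.eval M) (by simp [hr, List.replicate_succ])
        ?_).mono ?_
      · have e : (Cmd.ifZero r p q).eval s = q.eval s := by simp [Cmd.eval, hr]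
        have e' : s.setReg r (m + 1) = s := by rw [← hr, State.setReg_self]
        simp only [lay_reg, hr, List.replicate_succ, List.tail_cons, update_lay_reg, e]
        have h1 := execFrom_push (some (some true)) (Key.reg r) (fun _ => true)
          ((s.setReg r m).lay c [] [] [])
        simp only [lay_reg, State.setReg_reg_self, ← List.replicate_succ, update_lay_reg,
          State.setReg_setReg, e'] at h1
        exact h1.seq (ihq h c)
      · simp only [Cmd.cost, Polynomial.eval_add, Polynomial.eval_one, Polynomial.eval_ofNat]
        omega
  | copy v w => exact exec_copy h c v w
  | dec v =>
    have := exec_pop (Key.reg v) (s.lay c [] [] [])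
    simp only [lay_reg, List.tail_replicate, update_lay_reg] at this
    exact this.mono (by simp [Cmd.cost])
  | emit b =>
    have := exec_push Key.out b (s.lay c [] [] [])
    simp only [lay_out, update_lay_out] at this
    exact this.mono (by simp [Cmd.cost])
  | seq p q ihp ihq =>
    refine ((ihp h c).seq (ihq (h.eval p) c)).mono ?_
    simp [Cmd.cost]
  | forDown v w p ih =>
    have h1 := exec_push Key.ctl false (s.lay c [] [] [])
    simp only [lay_ctl, update_lay_ctl] at h1
    have h2 := exec_addTo (t := Key.t) (k := .ctl) (r := .reg w) (by simp) (by simp) (by simp)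
      (s.lay (false :: c) [] [] []) (s.reg w) rfl rfl
    simp only [lay_ctl, update_lay_ctl] at h2
    -- Induction on the remaining counter. At zero the loop pops the separator `false`, which both
    -- stops it and restores `c`.
    have h3 : ∀ m, m ≤ M → ∀ s : State, s.Bounded M →
        Exec (popWhile .ctl bit (.seq (loadCounter v) p.compile))
          (s.lay (List.replicate m true ++ false :: c) [] [] [])
          ((descend m (fun m s => p.eval (s.setReg v m)) s).lay c [] [] [])
          (m * ((((3 * M + 2) + ((3 * M + 2) + (1 + (4 * M + 2)))) + p.cost.eval M) + 2) + 2) := by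
      intro m
      induction m with
      | zero =>
        intro _ s _
        simpa [descend] using exec_popWhile_exit (k := Key.ctl) (f := bit)
          (p := .seq (loadCounter v) p.compile) (S := s.lay (false :: c) [] [] []) rfl
      | succ m ihm =>
        intro hm s hs
        have hm' : m ≤ M := by omega
        have hs' := hs.setReg v hm'
        have hb := (exec_loadCounter hs c v hm').seq (ih hs' (List.replicate m true ++ false :: c))
        refine (exec_popWhile_step (T := ((3 * M + 2) + ((3 * M + 2) + (1 + (4 * M + 2)))) +
            p.cost.eval M)
          (b := true) (l := List.replicate m true ++ false :: c)
          (by simp [List.replicate_succ]) rfl ?_ (ihm hm' _ (hs'.eval p))).mono (le_of_eq ?_)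
        · rw [update_lay_ctl]
          exact hb _
        · ring
    refine (h1.seq (h2.seq (h3 _ (h.1 w) s h))).mono ?_
    simp only [Cmd.cost, Polynomial.eval_add, Polynomial.eval_mul, Polynomial.eval_X,
      Polynomial.eval_ofNat, Polynomial.eval_one]
    have := h.1 w
    gcongr

end compile

end StackProgram

namespace StackProgram

/-! ### Reading the input and clearing the memory -/

/-- The registers and the array `adj` after the input has been read. -/
def State.init (l : List (Option Bool)) : State where
  reg
    | .order => l.count none
    | .stride => l.count none + 1
    | .size => l.length
    | _ => 0
  arr
    | .adj => l.map fun o => o.getD false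
    | _ => []
  out := []

/-- Process the input symbol read last. -/
def scanSymbol : Prog Key :=
  .ite (fun v => v == some none)
    (.seq (.push (.reg .order) fun _ => true) (.seq (.push (.reg .stride) fun _ => true)
      (.seq (.push (.reg .size) fun _ => true) (.push .t fun _ => false))))
    (.seq (.push (.reg .size) fun _ => true) (.push .t bit))

/-- Read the input. -/
def readInput : Prog Key :=
  .seq .popInput (.seq (.loop Option.isSome (.seq scanSymbol .popInput))
    (.seq (.push (.reg .stride) fun _ => true) (drain .t (.arr .adj))))

/-- The state after some symbols have been read. -/
def State.scanned (m n : ℕ) : State where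
  reg
    | .order => m
    | .stride => m
    | .size => n
    | _ => 0
  arr _ := []
  out := []

theorem runs_push_reg (s : State) (r : Reg) (v : Cell) (l : List (Option Bool))
    (c x y t : List Bool) :
    Runs (.push (.reg r) fun _ => true) ⟨v, l, s.lay c x y t⟩
      ⟨v, l, (s.setReg r (s.reg r + 1)).lay c x y t⟩ 1 := by
  have h := Runs.push (Key.reg r) (fun _ => true) ⟨v, l, s.lay c x y t⟩
  simpa only [lay_reg, ← List.replicate_succ, update_lay_reg] using h

theorem runs_push_t (s : State) (f : Cell → Bool) (v : Cell) (l : List (Option Bool))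
    (c x y t : List Bool) :
    Runs (.push .t f) ⟨v, l, s.lay c x y t⟩ ⟨v, l, s.lay c x y (f v :: t)⟩ 1 := by
  have h := Runs.push Key.t f ⟨v, l, s.lay c x y t⟩
  simpa only [lay_t, update_lay_t] using h

theorem runs_scanSymbol (o : Option Bool) (l : List (Option Bool)) (m n : ℕ) (t : List Bool) :
    ∃ T ≤ 5, Runs scanSymbol ⟨some o, l, (State.scanned m n).lay [] [] [] t⟩
      ⟨some o, l, (State.scanned (m + [o].count none) (n + 1)).lay [] [] [] (o.getD false :: t)⟩
      T := by
  rcases o with _ | b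
  · refine ⟨1 + (1 + (1 + (1 + 1))), le_rfl, .ite_true rfl ?_⟩
    have h := (runs_push_reg (State.scanned m n) .order (some none) l [] [] [] t).seq
      ((runs_push_reg _ .stride _ l [] [] [] t).seq
      ((runs_push_reg _ .size _ l [] [] [] t).seq
      (runs_push_t _ (fun _ => false) _ l [] [] [] t)))
    convert h using 3
    · ext1
      · funext r
        cases r <;> simp [State.scanned, State.setReg_reg]
      · rfl
      · rfl
    · rfl
  · refine ⟨1 + (1 + 1), by omega, .ite_false rfl ?_⟩
    have h := (runs_push_reg (State.scanned m n) .size (some (some b)) l [] [] [] t).seq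
      (runs_push_t _ bit _ l [] [] [] t)
    convert h using 3
    · ext1
      · funext r
        cases r <;> simp [State.scanned, State.setReg_reg]
      · rfl
      · rfl
    · simp

theorem runs_scanLoop (l : List (Option Bool)) (m n : ℕ) (t : List Bool) :
    ∃ T ≤ 7 * l.length + 1, Runs (.loop Option.isSome (.seq scanSymbol .popInput))
      ⟨l.head?, l.tail, (State.scanned m n).lay [] [] [] t⟩
      ⟨none, [], (State.scanned (m + l.count none) (n + l.length)).lay [] [] []
        ((l.map fun o => o.getD false).reverse ++ t)⟩ T := by
  induction l generalizing m n t with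
  | nil => exact ⟨1, le_rfl, .loop_done rfl⟩
  | cons o l ih =>
    obtain ⟨a, ha, h1⟩ := runs_scanSymbol o l m n t
    obtain ⟨b, hb, h2⟩ := ih (m + [o].count none) (n + 1) (o.getD false :: t)
    refine ⟨1 + ((a + 1) + b), by simp only [List.length_cons]; omega, ?_⟩
    refine .loop_step rfl (h1.seq (.popInput _)) ?_
    convert h2 using 3
    · simp only [List.count_cons, List.length_cons, List.count_nil]
      congr 1 <;> ring
    · simp

theorem runs_readInput (l : List (Option Bool)) : ∃ v, ∃ T ≤ 10 * l.length + 5,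
    Runs readInput ⟨none, l, fun _ => []⟩ ⟨v, [], (State.init l).lay [] [] [] []⟩ T := by
  obtain ⟨T, hT, h⟩ := runs_scanLoop l 0 0 []
  have e : (fun _ => []) = (State.scanned 0 0).lay [] [] [] [] := by
    funext k
    rcases k with _ | _ | _ | _ | _ | r | a <;> try rfl
    rcases r <;> rfl
  have h2 := exec_drain (a := Key.t) (b := .arr .adj) (by simp)
    (((State.scanned (0 + l.count none) (0 + l.length)).setReg .stride (l.count none + 1)).lay
      [] [] [] ((l.map fun o => o.getD false).reverse ++ []))
  obtain ⟨v, T', hT', h3⟩ := h2 none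
  have h1 := Runs.push (Key.reg .stride) (fun _ => true)
    ⟨none, [], ((State.scanned (0 + l.count none) (0 + l.length))).lay
      [] [] [] ((l.map fun o => o.getD false).reverse ++ [])⟩
  have e1 : true :: (State.scanned (0 + l.count none) (0 + l.length)).lay
      [] [] [] ((l.map fun o => o.getD false).reverse ++ []) (Key.reg .stride)
      = List.replicate (l.count none + 1) true := by
    simp [State.scanned, List.replicate_succ]
  simp only [e1, update_lay_reg] at h1
  rw [e]
  refine ⟨v, 1 + (T + (1 + T')), ?_, (Runs.popInput _).seq (h.seq (h1.seq ?_))⟩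
  · simp at hT'
    omega
  · convert h3 using 2
    funext k
    rcases k with _ | _ | _ | _ | _ | r | a <;> try simp
    · rfl
    · rcases r <;> simp [State.init, State.scanned, State.setReg_reg]
    · rcases a <;> simp [State.init, State.setArr_arr, State.scanned]

/-- The bound is `l.length + 1` rather than `l.length` because of the register `stride`. -/
theorem State.bounded_init (l : List (Option Bool)) : (State.init l).Bounded (l.length + 1) := by
  have := List.count_le_length (a := (none : Option Bool)) (l := l)
  refine ⟨fun r => ?_, fun a => ?_⟩
  · cases r <;> (simp [init]; try omega)
  · have : l.length ≤ (l.length + 1 + 1) ^ 3 := by nlinarith [Nat.zero_le (l.length ^ 2)]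
    cases a <;> simp [init]
    omega

/-- Clear some stacks and the finite memory. -/
def clearAll : List Key → Prog Key
  | [] => .popInput
  | k :: ks => .seq (clear k) (clearAll ks)

theorem runs_clearAll (ks : List Key) (S : Key → List Bool) (L : ℕ) (hS : ∀ k, (S k).length ≤ L)
    (v : Cell) : ∃ T ≤ ks.length * (3 * L + 2) + 1,
      Runs (clearAll ks) ⟨v, [], S⟩ ⟨none, [], fun k => if k ∈ ks then [] else S k⟩ T := by
  induction ks generalizing S v with
  -- The final `popInput` meets empty input, which resets the finite memory to `none`.
  | nil => exact ⟨1, by omega, by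
    simpa [clearAll] using Runs.popInput (⟨v, [], S⟩ : Store Key)⟩
  | cons k ks ih =>
    obtain ⟨v', t, ht, h⟩ := exec_clear k S v
    obtain ⟨T, hT, h'⟩ := ih (Function.update S k []) (fun k' => by
      rw [Function.update_apply]; split
      · simp
      · exact hS k') v'
    refine ⟨t + T, ?_, ?_⟩
    · have := hS k
      calc t + T ≤ (3 * L + 2) + (ks.length * (3 * L + 2) + 1) := by omega
        _ = _ := by simp only [List.length_cons]; ring
    · convert! h.seq h' using 2
      funext k'
      by_cases h1 : k' = k <;> simp [h1]

/-- The stacks that store the registers and the arrays. -/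
def memory : List Key :=
  [.reg .order, .reg .stride, .reg .size, .reg .zero, .reg .row, .reg .col, .reg .mid, .reg .fst,
    .reg .snd, .reg .thr, .reg .cnt, .reg .rnd, .arr .adj, .arr .ball, .arr .ball', .arr .closer,
    .arr .cov, .arr .out, .arr .flag]

/-- A halting configuration must have every stack empty except the output. There are 19 stacks to
clear, and a single length bound, which also allows for the output, is used for all of them. -/
theorem runs_clear_memory {M : ℕ} {s : State} (h : s.Bounded M) (v : Cell) :
    ∃ T ≤ 19 * (3 * ((M + 1) ^ 3 + s.out.length) + 2) + 1,
      Runs (clearAll memory) ⟨v, [], s.lay [] [] [] []⟩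
        ⟨none, [], Function.update (fun _ => []) .out s.out⟩ T := by
  have hM : M ≤ (M + 1) ^ 3 := by nlinarith [Nat.zero_le (M ^ 2)]
  have := runs_clearAll memory (s.lay [] [] [] []) ((M + 1) ^ 3 + s.out.length) ?_ v
  · have e : (fun k => if k ∈ memory then [] else s.lay [] [] [] [] k)
        = Function.update (fun _ => []) Key.out s.out := by
      funext k
      rcases k with _ | _ | _ | _ | _ | r | a <;> try simp [memory]
      · cases r <;> simp
      · cases a <;> simp
    rwa [e] at this
  · intro k
    rcases k with _ | _ | _ | _ | _ | r | a <;> simp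
    · exact ((h.1 r).trans hM).trans (Nat.le_add_right _ _)
    · exact (h.2 a).trans (Nat.le_add_right _ _)

/-- A function that is computed by a command is computable in polynomial time. -/
theorem computableInPolyTime_of_cmd (p : Cmd) {α β : Type} (ea : α → List (Option Bool))
    (eb : β → List Bool) (f : α → β) (h : ∀ a, (p.eval (State.init (ea a))).out = eb (f a))
    (hlen : ∀ a, (eb (f a)).length ≤ (ea a).length) :
    Nonempty (Turing.TM2ComputableInPolyTime ea eb f) := by
  -- The three summands pay for reading, for the command, and for clearing. The shift `X + 1` comes
  -- from the bound on the initial state, and `hlen` bounds the output by the input in the cost of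
  -- clearing.
  refine nonempty_computableInPolyTime Key.out
    (.seq readInput (.seq p.compile (clearAll memory))) ea eb f
    ((10 * Polynomial.X + 5) + (p.cost.comp (Polynomial.X + 1) +
      (19 * (3 * ((Polynomial.X + 1 + 1) ^ 3 + Polynomial.X) + 2) + 1))) fun a => ?_
  have hb := State.bounded_init (ea a)
  obtain ⟨v, t, ht, h1⟩ := runs_readInput (ea a)
  obtain ⟨v', t', ht', h2⟩ := p.exec_compile hb [] v
  obtain ⟨t'', ht'', h3⟩ := runs_clear_memory (hb.eval p) v'
  rw [h a] at ht'' h3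
  refine ⟨t + (t' + t''), ?_, h1.seq (h2.seq h3)⟩
  simp only [Polynomial.eval_add, Polynomial.eval_mul, Polynomial.eval_X, Polynomial.eval_ofNat,
    Polynomial.eval_one, Polynomial.eval_comp, Polynomial.eval_pow]
  refine Nat.add_le_add ht (Nat.add_le_add ht' (ht''.trans ?_))
  have := hlen a
  gcongr

end StackProgram

namespace StackProgram

/-! ### Derived commands -/

theorem descend_invariant {α : Type*} {n : ℕ} {f : ℕ → α → α} {x : α} (P : ℕ → α → Prop)
    (h0 : P n x) (h : ∀ m < n, ∀ y, P (m + 1) y → P m (f m y)) : P 0 (descend n f x) := by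
  induction n generalizing x with
  | zero => exact h0
  | succ n ih => exact ih (h n n.lt_succ_self x h0) fun m hm => h m (hm.trans n.lt_succ_self)

/-- Boolean tests of array cells. -/
inductive Test : Type
  | tt : Test
  | read : Arr → Reg → Reg → Reg → Test
  | not : Test → Test
  | and : Test → Test → Test
  | differ : Test → Test → Test

/-- The array cell with the given indices. -/
def State.get (s : State) (a : Arr) (i j k : ℕ) : Bool :=
  (s.arr a).getD ((i * s.reg .stride + j) * s.reg .stride + k) false

/-- The value of a test. -/
def Test.holds : Test → State → Bool
  | .tt, _ => true
  | .read a i j k, s => s.get a (s.reg i) (s.reg j) (s.reg k)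
  | .not e, s => !(e.holds s)
  | .and e f, s => e.holds s && f.holds s
  | .differ e f, s => e.holds s != f.holds s

/-- The test does not read the array `X`. -/
def Test.Avoids (X : Arr) : Test → Prop
  | .tt => True
  | .read a _ _ _ => a ≠ X
  | .not e => e.Avoids X
  | .and e f => e.Avoids X ∧ f.Avoids X
  | .differ e f => e.Avoids X ∧ f.Avoids X

/-- This makes the order of the iterations irrelevant in loops that write only to `X`. -/
theorem Test.holds_congr {X : Arr} (e : Test) (he : e.Avoids X) {s s' : State}
    (hreg : s'.reg = s.reg) (harr : ∀ a ≠ X, s'.arr a = s.arr a) : e.holds s' = e.holds s := by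
  induction e with
  | tt => rfl
  | read a i j k => simp only [holds, State.get, hreg, harr a he]
  | not e ih => simp only [holds, ih he]
  | and e f ihe ihf => simp only [holds, ihe he.1, ihf he.2]
  | differ e f ihe ihf => simp only [holds, ihe he.1, ihf he.2]

/-- Branch on a test. -/
def Cmd.cond : Test → Cmd → Cmd → Cmd
  | .tt, p, _ => p
  | .read a i j k, p, q => .ifRead a i j k p q
  | .not e, p, q => cond e q p
  | .and e f, p, q => cond e (cond f p q) q
  | .differ e f, p, q => cond e (cond f q p) (cond f p q)

theorem Cmd.eval_cond (e : Test) (p q : Cmd) (s : State) :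
    (Cmd.cond e p q).eval s = if e.holds s = true then p.eval s else q.eval s := by
  induction e generalizing p q with
  | tt => rfl
  | read a i j k => rfl
  | not e ih =>
    rw [cond, ih, Test.holds]
    cases e.holds s <;> rfl
  | and e f ihe ihf =>
    rw [cond, ihe, ihf, Test.holds]
    cases e.holds s <;> cases f.holds s <;> rfl
  | differ e f ihe ihf =>
    rw [cond, ihe, ihf, ihf, Test.holds]
    cases e.holds s <;> cases f.holds s <;> rfl

/-! ### Loops that mark and count -/

/-- `s'` differs from `s` only in the registers in `R` and in the array `X`. -/
structure Agree (R : Set Reg) (X : Arr) (s s' : State) : Prop where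
  reg : ∀ r ∉ R, s'.reg r = s.reg r
  arr : ∀ a ≠ X, s'.arr a = s.arr a
  out : s'.out = s.out

namespace Agree

variable {R R' : Set Reg} {X : Arr} {s s' s'' : State}

theorem refl (R : Set Reg) (X : Arr) (s : State) : Agree R X s s :=
  ⟨fun _ _ => rfl, fun _ _ => rfl, rfl⟩

theorem trans (h : Agree R X s s') (h' : Agree R X s' s'') : Agree R X s s'' :=
  ⟨fun r hr => (h'.reg r hr).trans (h.reg r hr), fun a ha => (h'.arr a ha).trans (h.arr a ha),
    h'.out.trans h.out⟩

theorem mono (h : Agree R X s s') (hR : R ⊆ R') : Agree R' X s s' :=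
  ⟨fun r hr => h.reg r fun h' => hr (hR h'), h.arr, h.out⟩

theorem setReg (R : Set Reg) (X : Arr) (s : State) {v : Reg} (hv : v ∈ R) (m : ℕ) :
    Agree R X s (s.setReg v m) :=
  ⟨fun r hr => by rw [State.setReg_reg, if_neg]; rintro rfl; exact hr hv, fun _ _ => rfl, rfl⟩

theorem setArr (R : Set Reg) (X : Arr) (s : State) (l : List Bool) : Agree R X s (s.setArr X l) :=
  ⟨fun _ _ => rfl, fun a ha => by rw [State.setArr_arr, if_neg ha], rfl⟩

theorem get (h : Agree R X s s') (hR : Reg.stride ∉ R) {a : Arr} (ha : a ≠ X) (i j k : ℕ) :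
    s'.get a i j k = s.get a i j k := by
  simp only [State.get, h.arr a ha, h.reg _ hR]

end Agree

@[simp] theorem State.get_setReg {s : State} {v : Reg} (hv : v ≠ .stride) (m : ℕ) (a : Arr)
    (i j k : ℕ) : (s.setReg v m).get a i j k = s.get a i j k := by
  simp [State.get, State.setReg_reg, hv.symm]

theorem address_inj {w i j k i' j' k' : ℕ} (hj : j < w) (hk : k < w) (hj' : j' < w) (hk' : k' < w)
    (h : (i * w + j) * w + k = (i' * w + j') * w + k') : i = i' ∧ j = j' ∧ k = k' := by
  have aux : ∀ {a b c d : ℕ}, b < w → d < w → a * w + b = c * w + d → a = c ∧ b = d := by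
    intro a b c d hb hd h
    have h1 : (a * w + b) / w = a := by
      rw [Nat.add_comm, Nat.add_mul_div_right _ _ (by omega), Nat.div_eq_of_lt hb, Nat.zero_add]
    have h2 : (c * w + d) / w = c := by
      rw [Nat.add_comm, Nat.add_mul_div_right _ _ (by omega), Nat.div_eq_of_lt hd, Nat.zero_add]
    have : a = c := by rw [← h1, h, h2]
    subst this
    exact ⟨rfl, by omega⟩
  obtain ⟨h1, h2⟩ := aux hk hk' h
  obtain ⟨h3, h4⟩ := aux hj hj' h1
  exact ⟨h3, h4, h2⟩

/-- Only the last two indices need to be below `stride`: the address is a positional notation whose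
leading digit is unrestricted. -/
theorem get_write (s : State) (a : Arr) (p q r : Reg) (b : Bool)
    (hq : s.reg q < s.reg .stride) (hr : s.reg r < s.reg .stride) {i j k : ℕ}
    (hj : j < s.reg .stride) (hk : k < s.reg .stride) :
    ((Cmd.write a p q r b).eval s).get a i j k =
      if i = s.reg p ∧ j = s.reg q ∧ k = s.reg r then b else s.get a i j k := by
  simp only [Cmd.eval, State.get, State.setArr_reg, State.setArr_arr_self, getD_setAt, State.addr]
  congr 1
  refine propext ⟨fun h => address_inj hj hk hq hr h, ?_⟩
  rintro ⟨rfl, rfl, rfl⟩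
  rfl

/-- `s'` differs from `s` only in the registers in `R` and in that the cells in `D` of the array `X`
have been set. -/
structure Marks (R : Set Reg) (X : Arr) (s s' : State) (D : ℕ → ℕ → ℕ → Prop) : Prop
    extends Agree R X s s' where
  get_iff : ∀ i j k, j < s.reg .stride → k < s.reg .stride →
    (s'.get X i j k = true ↔ s.get X i j k = true ∨ D i j k)

theorem Marks.mono {R R' : Set Reg} {X : Arr} {s s' : State} {D : ℕ → ℕ → ℕ → Prop}
    (h : Marks R X s s' D) (hR : R ⊆ R') : Marks R' X s s' D :=
  ⟨h.toAgree.mono hR, h.get_iff⟩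

/-- The loop counts down, so the invariant at `m` collects the cells due to the indices from `m`
upwards. The sets `D m` are fixed beforehand, which is legitimate when the body does not depend on
earlier writes to `X`. -/
theorem marks_for {R : Set Reg} (hR : Reg.stride ∉ R) {X : Arr} {v w : Reg} (hv : v ∈ R) {p : Cmd}
    {s : State} (D : ℕ → ℕ → ℕ → ℕ → Prop)
    (h : ∀ m < s.reg w, ∀ s', Agree R X s s' → s'.reg v = m → Marks R X s' (p.eval s') (D m)) :
    Marks R X s ((Cmd.forDown v w p).eval s) fun i j k => ∃ m < s.reg w, D m i j k := by
  have key := descend_invariant (n := s.reg w) (f := fun m s => p.eval (s.setReg v m)) (x := s)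
    (fun m s' => Marks R X s s' fun i j k => ∃ m' < s.reg w, m ≤ m' ∧ D m' i j k) ?_ ?_
  · refine ⟨key.toAgree, fun i j k hj hk => ?_⟩
    rw [Cmd.eval, key.get_iff i j k hj hk]
    simp
  · refine ⟨Agree.refl _ _ _, fun i j k _ _ => ?_⟩
    refine ⟨Or.inl, ?_⟩
    rintro (h | ⟨m, h1, h2, _⟩)
    · exact h
    · omega
  · intro m hm s' hs'
    have hv' : v ≠ .stride := by rintro rfl; exact hR hv
    have h0 : Agree R X s (s'.setReg v m) := hs'.toAgree.trans (Agree.setReg R X s' hv m)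
    have h1 := h m hm _ h0 (by simp)
    have hst : (s'.setReg v m).reg .stride = s.reg .stride := h0.reg _ hR
    refine ⟨h0.trans h1.toAgree, fun i j k hj hk => ?_⟩
    rw [h1.get_iff i j k (by omega) (by omega), State.get_setReg hv', hs'.get_iff i j k hj hk,
      or_assoc]
    refine or_congr_right ⟨?_, ?_⟩
    · rintro (⟨m', h2, h3, h4⟩ | h4)
      · exact ⟨m', h2, by omega, h4⟩
      · exact ⟨m, hm, le_rfl, h4⟩
    · rintro ⟨m', h2, h3, h4⟩
      rcases h3.eq_or_lt with rfl | h3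
      · exact Or.inr h4
      · exact Or.inl ⟨m', h2, h3, h4⟩

/-- Set the loop registers. -/
def State.at (s : State) (i j k : ℕ) : State :=
  ((s.setReg .row i).setReg .col j).setReg .mid k

/-- For all values of the loop registers that satisfy a test, set an array cell. -/
def Cmd.mark (X : Arr) (p q r : Reg) (e : Test) : Cmd :=
  .forDown .row .order (.forDown .col .order (.forDown .mid .order
      (.cond e (.write X p q r true) .skip)))

/-- Three applications of `marks_for`. As the test avoids `X`, its value inside the loops is its
value in the original state with the loop registers set. -/
theorem marks_mark {X : Arr} {p q r : Reg} {e : Test} (he : e.Avoids X) {s : State}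
    (hq : ∀ i j k, i < s.reg .order → j < s.reg .order → k < s.reg .order →
      (s.at i j k).reg q < s.reg .stride)
    (hr : ∀ i j k, i < s.reg .order → j < s.reg .order → k < s.reg .order →
      (s.at i j k).reg r < s.reg .stride) :
    Marks {.row, .col, .mid} X s ((Cmd.mark X p q r e).eval s) fun u v w =>
      ∃ i < s.reg .order, ∃ j < s.reg .order, ∃ k < s.reg .order, e.holds (s.at i j k) = true ∧
        u = (s.at i j k).reg p ∧ v = (s.at i j k).reg q ∧ w = (s.at i j k).reg r := by
  refine marks_for (by simp) (by simp) _ fun i hi s₁ h₁ hs₁ => ?_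
  have ho₁ : s₁.reg .order = s.reg .order := h₁.reg _ (by simp)
  rw [← ho₁]
  refine Marks.mono (R := {.col, .mid}) ?_ (by simp)
  refine marks_for (by simp) (by simp) _ fun j hj s₂ h₂ hs₂ => ?_
  have ho₂ : s₂.reg .order = s₁.reg .order := h₂.reg _ (by simp)
  rw [← ho₂]
  refine Marks.mono (R := {.mid}) ?_ (by simp)
  refine marks_for (by simp) (by simp) _ fun k hk s₃ h₃ hs₃ => ?_
  -- Each inner loop may change only its own registers, so the outer indices are still in place.
  have hreg : s₃.reg = (s.at i j k).reg := by
    funext x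
    have e1 : x ≠ .row → x ≠ .col → x ≠ .mid → s₃.reg x = s.reg x := fun h h' h'' => by
      rw [h₃.reg x (by simpa using h''), h₂.reg x (by simp [h', h'']), h₁.reg x
          (by simp [h, h', h''])]
    have e2 : s₃.reg .row = i := by rw [h₃.reg _ (by simp), h₂.reg _ (by simp), hs₁]
    have e3 : s₃.reg .col = j := by rw [h₃.reg _ (by simp), hs₂]
    by_cases hx : x = .mid
    · subst hx; simp [State.at, hs₃]
    · by_cases hx' : x = .col
      · subst hx'; simp [State.at, State.setReg_reg, e3]
      · by_cases hx'' : x = .row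
        · subst hx''; simp [State.at, State.setReg_reg, e2]
        · rw [e1 hx'' hx' hx]; simp [State.at, State.setReg_reg, hx, hx', hx'']
  have hold : e.holds s₃ = e.holds (s.at i j k) := by
    refine e.holds_congr he hreg fun a ha => ?_
    rw [h₃.arr a ha, h₂.arr a ha, h₁.arr a ha]; rfl
  rw [Cmd.eval_cond, hold, ← hreg]
  have hst : s₃.reg .stride = s.reg .stride := by rw [hreg]; simp [State.at, State.setReg_reg]
  have hq' := hq i j k hi (by omega) (by omega)
  have hr' := hr i j k hi (by omega) (by omega)
  rw [← hst, ← hreg] at hq' hr'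
  split
  · refine ⟨Agree.setArr _ _ _ _, fun u v w hv hw => ?_⟩
    rw [get_write s₃ X p q r true hq' hr' hv hw]
    split
    · simp [*]
    · rename_i h
      rw [hreg] at h
      simp only [*]
      simp
  · refine ⟨Agree.refl _ _ _, fun u v w _ _ => ?_⟩
    simp [*, Cmd.eval]

/-- `s'` differs from `s` in that `m` has been subtracted from the register `cnt`, and the cell
`flag` has been set if `m` exceeded `cnt`. -/
structure Counts (R : Set Reg) (s s' : State) (m : ℕ) : Prop extends Agree R .flag s s' where
  cnt : s'.reg .cnt = s.reg .cnt - m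
  flag : s'.get .flag 0 0 0 = true ↔ s.get .flag 0 0 0 = true ∨ s.reg .cnt < m

theorem Counts.mono {R R' : Set Reg} {s s' : State} {m : ℕ}
    (h : Counts R s s' m) (hR : R ⊆ R') : Counts R' s s' m :=
  ⟨h.toAgree.mono hR, h.cnt, h.flag⟩

/-- Truncated subtraction composes: running into zero at any stage is recorded in `flag`, so in the
end the flag tells whether the total exceeds the initial `cnt`. -/
theorem counts_for {R : Set Reg} (hR : Reg.stride ∉ R) {v w : Reg} (hv : v ∈ R) (hc : v ≠ .cnt)
    {p : Cmd} {s : State} (f : ℕ → ℕ)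
    (h : ∀ m < s.reg w, ∀ s', Agree R .flag s s' → s'.reg v = m → Counts R s' (p.eval s') (f m)) :
    Counts R s ((Cmd.forDown v w p).eval s) (∑ m ∈ Finset.range (s.reg w), f m) := by
  have key := descend_invariant (n := s.reg w) (f := fun m s => p.eval (s.setReg v m)) (x := s)
    (fun m s' => Counts R s s' (∑ m' ∈ Finset.Ico m (s.reg w), f m')) ?_ ?_
  · rw [Finset.range_eq_Ico]
    exact key
  · exact ⟨Agree.refl _ _ _, by simp, by simp⟩
  · intro m hm s' hs'
    have hv' : v ≠ .stride := by rintro rfl; exact hR hv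
    have h0 : Agree R .flag s (s'.setReg v m) := hs'.toAgree.trans (Agree.setReg R .flag s' hv m)
    have h1 := h m hm _ h0 (by simp)
    have e : (s'.setReg v m).reg .cnt = s'.reg .cnt := by simp [State.setReg_reg, hc.symm]
    rw [Finset.sum_eq_sum_Ico_succ_bot hm]
    have hcnt := hs'.cnt
    refine ⟨h0.trans h1.toAgree, ?_, ?_⟩
    · rw [h1.cnt, e, hcnt]; omega
    · rw [h1.flag, State.get_setReg hv', hs'.flag, e, hcnt, or_assoc]
      refine or_congr_right ?_
      omega

/-- Subtract the number of pairs of loop registers that satisfy a test from `cnt`, and set `flag` if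
this number is too large. -/
def Cmd.count (e : Test) : Cmd :=
  .forDown .row .order (.forDown .col .order (.cond e
    (.ifZero .cnt (.write .flag .zero .zero .zero true) (.dec .cnt)) .skip))

/-- With `cnt` set to a threshold, `flag` answers whether more loop pairs than that satisfy the
test, without a separate comparison of numbers. The test must not depend on `cnt`, which changes
meanwhile. -/
theorem counts_count {e : Test} (he : e.Avoids .flag) {s : State} (hz : s.reg .zero = 0)
    (hst : 0 < s.reg .stride)
    (hcnt : ∀ s c, e.holds (s.setReg .cnt c) = e.holds s) :
    Counts {.row, .col, .cnt} s ((Cmd.count e).eval s)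
      (∑ i ∈ Finset.range (s.reg .order), ∑ j ∈ Finset.range (s.reg .order),
        if e.holds ((s.setReg .row i).setReg .col j) = true then 1 else 0) := by
  refine counts_for (by simp) (by simp) (by simp) _ fun i hi s₁ h₁ hs₁ => ?_
  have ho₁ : s₁.reg .order = s.reg .order := h₁.reg _ (by simp)
  rw [← ho₁]
  refine Counts.mono (R := {.col, .cnt}) ?_ (by simp)
  refine counts_for (by simp) (by simp) (by simp) _ fun j hj s₂ h₂ hs₂ => ?_
  refine Counts.mono (R := {.cnt}) ?_ (by simp)
  have hreg : s₂.reg = (((s.setReg .row i).setReg .col j).setReg .cnt (s₂.reg .cnt)).reg := by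
    funext x
    have e2 : s₂.reg .row = i := by rw [h₂.reg _ (by simp), hs₁]
    by_cases hx : x = .cnt
    · subst hx; simp
    · by_cases hx' : x = .col
      · subst hx'; simp [State.setReg_reg, hs₂]
      · by_cases hx'' : x = .row
        · subst hx''; simp [State.setReg_reg, e2]
        · rw [h₂.reg x (by simp [hx, hx']), h₁.reg x (by simp [hx, hx', hx''])]
          simp [State.setReg_reg, hx, hx', hx'']
  have hold : e.holds s₂ = e.holds ((s.setReg .row i).setReg .col j) := by
    rw [← hcnt ((s.setReg .row i).setReg .col j) (s₂.reg .cnt)]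
    refine e.holds_congr he hreg fun a ha => ?_
    rw [h₂.arr a ha, h₁.arr a ha]; rfl
  have hz₂ : s₂.reg .zero = 0 := by rw [h₂.reg _ (by simp), h₁.reg _ (by simp), hz]
  have hst₂ : 0 < s₂.reg .stride := by rwa [h₂.reg _ (by simp), h₁.reg _ (by simp)]
  rw [Cmd.eval_cond, hold]
  split
  · by_cases hc : s₂.reg .cnt = 0
    · have e1 : (Cmd.ifZero .cnt (.write .flag .zero .zero .zero true) (.dec .cnt)).eval s₂
          = (Cmd.write .flag .zero .zero .zero true).eval s₂ := if_pos hc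
      rw [e1]
      refine ⟨Agree.setArr _ _ _ _, ?_, ?_⟩
      · simp [Cmd.eval, hc]
      · rw [get_write s₂ .flag .zero .zero .zero true (by omega) (by omega) hst₂ hst₂]
        simp [hz₂, hc]
    · have e1 : (Cmd.ifZero .cnt (.write .flag .zero .zero .zero true) (.dec .cnt)).eval s₂
          = s₂.setReg .cnt (s₂.reg .cnt - 1) := if_neg hc
      rw [e1]
      refine ⟨Agree.setReg _ _ _ (by simp) _, by simp, ?_⟩
      rw [State.get_setReg (by simp)]
      simp [hc]
  · exact ⟨Agree.refl _ _ _, by simp [Cmd.eval], by simp [Cmd.eval]⟩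

end StackProgram

/-! ### Greedy set covers -/

namespace GreedyCover

open Finset StackProgram

variable {Q P : Type*} [DecidableEq P]

/-- The points covered by some of the sets `S q`. -/
def covered (S : Q → Finset P) (C : Finset Q) : Finset P := C.biUnion S

/-- Add `q` to the cover if it covers more than `t` new points. -/
def greedyStep [DecidableEq Q] (S : Q → Finset P) (t : ℕ) (q : Q) (C : Finset Q) : Finset Q :=
  if t < #(S q \ covered S C) then insert q C else C

theorem subset_greedyStep [DecidableEq Q] (S : Q → Finset P) (t : ℕ) (q : Q) (C : Finset Q) :
    C ⊆ greedyStep S t q C := by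
  unfold greedyStep
  split
  exacts [subset_insert _ _, Subset.rfl]

theorem card_sdiff_covered_mono (S : Q → Finset P) {C C' : Finset Q} (h : C ⊆ C') (q : Q) :
    #(S q \ covered S C') ≤ #(S q \ covered S C) :=
  card_le_card (sdiff_subset_sdiff Subset.rfl (biUnion_subset_biUnion_of_subset_left _ h))

/-- Either `q` was taken and covers nothing new any more, or it was refused for covering at most `t`
new points. -/
theorem card_greedyStep_le [DecidableEq Q] (S : Q → Finset P) (t : ℕ) (q : Q) (C : Finset Q) :
    #(S q \ covered S (greedyStep S t q C)) ≤ t := by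
  unfold greedyStep
  split
  · have : S q \ covered S (insert q C) = ∅ := by
      simp [covered, sdiff_eq_empty_iff_subset]
    simp [this]
  · omega

/-- The difference is a sum of `g` reciprocals, each at least `1 / u`. -/
theorem harmonic_sub_le {u g : ℕ} (hg : g ≤ u) (hu : 0 < u) :
    (g : ℚ) / u ≤ harmonic u - harmonic (u - g) := by
  obtain ⟨d, rfl⟩ : ∃ d, u = d + g := ⟨u - g, by omega⟩
  rw [Nat.add_sub_cancel]
  unfold harmonic
  rw [sum_range_add, add_sub_cancel_left]
  have : ∀ i ∈ range g, ((d + g : ℕ) : ℚ)⁻¹ ≤ ((d + i + 1 : ℕ) : ℚ)⁻¹ := fun i hi => by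
    have := mem_range.1 hi
    apply inv_anti₀
    · positivity
    · exact_mod_cast (by omega : d + i + 1 ≤ d + g)
  have h := card_nsmul_le_sum _ _ _ this
  rw [card_range, nsmul_eq_mul, ← div_eq_mul_inv] at h
  exact h

/-- The potential of a partial cover does not increase in a greedy step. -/
theorem potential_greedyStep [DecidableEq Q] (S : Q → Finset P) {U : Finset P} {D C : Finset Q}
    {t : ℕ} {q : Q}
    (hq : S q ⊆ U) (hD : U ⊆ covered S D) (ht : ∀ q ∈ D, #(S q \ covered S C) ≤ t + 1) :
    (#(greedyStep S t q C) : ℚ) + #D * harmonic #(U \ covered S (greedyStep S t q C))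
      ≤ #C + #D * harmonic #(U \ covered S C) := by
  unfold greedyStep
  split
  · rename_i hlt
    have e : U \ covered S (insert q C) = (U \ covered S C) \ (S q \ covered S C) := by
      ext p; simp [covered]; tauto
    have hsub : S q \ covered S C ⊆ U \ covered S C := sdiff_subset_sdiff hq Subset.rfl
    have hcard : #(U \ covered S (insert q C)) = #(U \ covered S C) - #(S q \ covered S C) := by
      rw [e, card_sdiff_of_subset hsub]
    have hle := card_le_card hsub
    have hpos : 0 < #(U \ covered S C) := by omega
    have hh := harmonic_sub_le hle hpos
    rw [← hcard] at hh
    -- The cover `D` also covers the remaining points, and each of its members contributes at most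
    -- `t + 1` of them.
    have hU : #(U \ covered S C) ≤ #D * (t + 1) := by
      refine (card_le_card (t := D.biUnion fun q => S q \ covered S C) fun p hp => ?_).trans
        (card_biUnion_le_card_mul _ _ _ ht)
      rw [mem_sdiff] at hp
      obtain ⟨q', hq', hp'⟩ := mem_biUnion.1 (hD hp.1)
      exact mem_biUnion.2 ⟨q', hq', mem_sdiff.2 ⟨hp', hp.2⟩⟩
    -- The set taken covers at least `t + 1` new points, so the harmonic part of the potential drops
    -- by at least the 1 that the new member costs.
    have h1 : (1 : ℚ) ≤ #D * (#(S q \ covered S C) / #(U \ covered S C)) := by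
      rw [← mul_div_assoc, le_div_iff₀ (by exact_mod_cast hpos), one_mul]
      exact_mod_cast hU.trans (Nat.mul_le_mul_left _ hlt)
    have h2 : (#(insert q C) : ℚ) ≤ #C + 1 := by exact_mod_cast card_insert_le q C
    have h3 := mul_le_mul_of_nonneg_left hh (Nat.cast_nonneg (α := ℚ) #D)
    rw [mul_sub] at h3
    linarith
  · exact le_rfl

/-- One pass over all pairs below `n` with a fixed threshold. -/
def pass (S : ℕ × ℕ → Finset P) (n t : ℕ) (C : Finset (ℕ × ℕ)) : Finset (ℕ × ℕ) :=
  descend n (fun a C => descend n (fun b C => greedyStep S t (a, b) C) C) C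

/-- The greedy cover: passes with decreasing thresholds. -/
def greedy (S : ℕ × ℕ → Finset P) (n L : ℕ) : Finset (ℕ × ℕ) :=
  descend L (fun t C => pass S n t C) ∅

/-! ### Analysis of the threshold greedy algorithm -/

section analysis

variable {S : ℕ × ℕ → Finset P} {n : ℕ} {U : Finset P} {D : Finset (ℕ × ℕ)}

/-- No pair below `n` covers more than `t` new points, and the potential is bounded. -/
structure Inv (S : ℕ × ℕ → Finset P) (n : ℕ) (U : Finset P) (D : Finset (ℕ × ℕ)) (t : ℕ)
    (C : Finset (ℕ × ℕ)) : Prop where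
  card_le : ∀ a < n, ∀ b < n, #(S (a, b) \ covered S C) ≤ t
  potential : (#C : ℚ) + #D * harmonic #(U \ covered S C) ≤ #D * harmonic #U

/-- One visit per pair suffices: after its visit a pair covers at most `t` new points, and this
number only falls as the cover grows. The nested invariants say which pairs have been visited by the
downward loops. -/
theorem Inv.pass (hS : ∀ a < n, ∀ b < n, S (a, b) ⊆ U) (hU : U ⊆ covered S D)
    (hD : ∀ q ∈ D, q.1 < n ∧ q.2 < n) {t : ℕ} {C : Finset (ℕ × ℕ)} (h : Inv S n U D (t + 1) C) :
    Inv S n U D t (pass S n t C) := by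
  have key := descend_invariant (n := n)
    (f := fun a C => descend n (fun b C => greedyStep S t (a, b) C) C) (x := C)
    (fun m C => Inv S n U D (t + 1) C ∧ ∀ a < n, ∀ b < n, m ≤ a → #(S (a, b) \ covered S C) ≤ t)
    ⟨h, fun a ha b _ hna => absurd ha (by omega)⟩ ?_
  · exact ⟨fun a ha b hb => key.2 a ha b hb (Nat.zero_le _), key.1.potential⟩
  intro m hm C' hC'
  have key' := descend_invariant (n := n) (f := fun b C => greedyStep S t (m, b) C) (x := C')
    (fun m' C => Inv S n U D (t + 1) C ∧ ∀ a < n, ∀ b < n, m + 1 ≤ a ∨ a = m ∧ m' ≤ b →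
      #(S (a, b) \ covered S C) ≤ t)
    ⟨hC'.1, fun a ha b hb hab => hC'.2 a ha b hb (by omega)⟩ ?_
  · exact ⟨key'.1, fun a ha b hb hma => key'.2 a ha b hb (by omega)⟩
  intro m' hm' C'' hC''
  have hmono := card_sdiff_covered_mono S (subset_greedyStep S t (m, m') C'')
  refine ⟨⟨fun a ha b hb => (hmono (a, b)).trans (hC''.1.card_le a ha b hb), ?_⟩,
    fun a ha b hb hab => ?_⟩
  · exact (potential_greedyStep S (hS m hm m' hm') hU fun q hq =>
      hC''.1.card_le q.1 (hD q hq).1 q.2 (hD q hq).2).trans hC''.1.potential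
  · by_cases hq : a = m ∧ b = m'
    · rw [hq.1, hq.2]
      exact card_greedyStep_le S t (m, m') C''
    · exact (hmono (a, b)).trans (hC''.2 a ha b hb (by omega))

theorem inv_greedy (hS : ∀ a < n, ∀ b < n, S (a, b) ⊆ U) (hU : U ⊆ covered S D)
    (hD : ∀ q ∈ D, q.1 < n ∧ q.2 < n) {L : ℕ} (hL : #U ≤ L) :
    Inv S n U D 0 (greedy S n L) := by
  refine descend_invariant (n := L) (fun t C => Inv S n U D t C) ?_ fun t _ C hC =>
    hC.pass hS hU hD
  -- At the start no set can cover more than `#U ≤ L` points.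
  refine ⟨fun a ha b hb => ?_, by simp [covered]⟩
  exact ((card_le_card sdiff_subset).trans (card_le_card (hS a ha b hb))).trans hL

/-- The greedy cover covers everything, and it is at most a logarithmic factor larger than any other
cover. -/
theorem greedy_covers (hS : ∀ a < n, ∀ b < n, S (a, b) ⊆ U) (hU : U ⊆ covered S D)
    (hD : ∀ q ∈ D, q.1 < n ∧ q.2 < n) {L : ℕ} (hL : #U ≤ L) :
    U ⊆ covered S (greedy S n L) := by
  intro p hp
  obtain ⟨q, hq, hpq⟩ := mem_biUnion.1 (hU hp)
  have h := (inv_greedy hS hU hD hL).card_le q.1 (hD q hq).1 q.2 (hD q hq).2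
  rw [Nat.le_zero, card_eq_zero, sdiff_eq_empty_iff_subset] at h
  exact h hpq

/-- The potential starts at `#D` times the harmonic number of `#U` and always bounds the size of the
partial cover. -/
theorem card_greedy_le (hS : ∀ a < n, ∀ b < n, S (a, b) ⊆ U) (hU : U ⊆ covered S D)
    (hD : ∀ q ∈ D, q.1 < n ∧ q.2 < n) {L : ℕ} (hL : #U ≤ L) :
    (#(greedy S n L) : ℝ) ≤ #D * (1 + Real.log #U) := by
  have h := (inv_greedy hS hU hD hL).potential
  have h0 : (0 : ℚ) ≤ #D * harmonic #(U \ covered S (greedy S n L)) := by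
    unfold harmonic; positivity
  have h1 : (#(greedy S n L) : ℚ) ≤ #D * harmonic #U := by linarith
  have h2 : (#(greedy S n L) : ℝ) ≤ #D * (harmonic #U : ℝ) := by exact_mod_cast h1
  exact h2.trans (mul_le_mul_of_nonneg_left (harmonic_le_one_add_log _) (Nat.cast_nonneg _))

theorem greedy_subset (L : ℕ) : ∀ q ∈ greedy S n L, q.1 < n ∧ q.2 < n := by
  refine descend_induction (P := fun C : Finset (ℕ × ℕ) => ∀ q ∈ C, q.1 < n ∧ q.2 < n)
      (fun t _ C hC => ?_) (by simp)
  refine descend_induction (P := fun C : Finset (ℕ × ℕ) => ∀ q ∈ C, q.1 < n ∧ q.2 < n)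
      (fun a ha C hC => ?_) hC
  refine descend_induction (P := fun C : Finset (ℕ × ℕ) => ∀ q ∈ C, q.1 < n ∧ q.2 < n)
      (fun b hb C hC => ?_) hC
  intro q hq
  unfold greedyStep at hq
  split at hq
  · rcases mem_insert.1 hq with rfl | hq
    exacts [⟨ha, hb⟩, hC q hq]
  · exact hC q hq

end analysis

end GreedyCover

/-! ### Rank orderings -/

section RankOrdering

variable {V : Type*} (G : SimpleGraph V) (B : Finset V)

theorem mem_rankOrdering {x : V} {X : Finset V} :
    X ∈ rankOrdering G B x ↔ ∃ b ∈ B, X = B.filter fun c => G.edist x c = G.edist x b := by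
  simp only [rankOrdering, List.mem_map, Finset.mem_sort, Finset.mem_image]
  constructor
  · rintro ⟨d, ⟨b, hb, rfl⟩, rfl⟩
    exact ⟨b, hb, rfl⟩
  · rintro ⟨b, hb, rfl⟩
    exact ⟨_, ⟨b, hb, rfl⟩, rfl⟩

theorem rankOrdering_pairwise (x : V) :
    (rankOrdering G B x).Pairwise fun X Y => ∀ a ∈ X, ∀ b ∈ Y, G.edist x a < G.edist x b := by
  unfold rankOrdering
  rw [List.pairwise_map]
  refine (Finset.sortedLT_sort (B.image (G.edist x))).pairwise.imp fun {d d'} hd a ha b hb => ?_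
  rw [(Finset.mem_filter.1 ha).2, (Finset.mem_filter.1 hb).2]
  exact hd

/-- The class of `a` precedes the class of `b` in the list of `x`. The same list belongs to `y`, and
there position again means increasing distance. -/
theorem edist_lt_of_rankOrdering_eq {x y : V}
    (h : rankOrdering G B x = rankOrdering G B y) {a b : V}
    (ha : a ∈ B) (hb : b ∈ B) (hab : G.edist x a < G.edist x b) : G.edist y a < G.edist y b := by
  have hA := (mem_rankOrdering G B (x := x)).2 ⟨a, ha, rfl⟩
  have hB := (mem_rankOrdering G B (x := x)).2 ⟨b, hb, rfl⟩
  have ha' : a ∈ B.filter fun c => G.edist x c = G.edist x a := Finset.mem_filter.2 ⟨ha, rfl⟩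
  have hb' : b ∈ B.filter fun c => G.edist x c = G.edist x b := Finset.mem_filter.2 ⟨hb, rfl⟩
  obtain ⟨i, hi, hia⟩ := List.mem_iff_getElem.1 hA
  obtain ⟨j, hj, hjb⟩ := List.mem_iff_getElem.1 hB
  rw [← hia] at ha'
  rw [← hjb] at hb'
  have hx := List.pairwise_iff_getElem.1 (rankOrdering_pairwise G B x)
  have hy := List.pairwise_iff_getElem.1 (rankOrdering_pairwise G B y)
  rcases lt_trichotomy i j with hij | rfl | hij
  · simp only [h] at ha' hb' hi hj
    exact hy i j hi hj hij a ha' b hb'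
  · rw [hia] at hjb
    rw [hia] at hb'
    exact absurd (Finset.mem_filter.1 hb').2 hab.ne'
  · exact absurd (hx j i hj hi hij b hb' a ha') hab.asymm

/-- Conversely, equal comparisons give the same classes, and both lists, free of repetitions, are
sorted by the same strict relation on these classes, so they coincide. -/
theorem rankOrdering_eq_iff {x y : V} : rankOrdering G B x = rankOrdering G B y ↔
    ∀ a ∈ B, ∀ b ∈ B, (G.edist x a < G.edist x b ↔ G.edist y a < G.edist y b) := by
  refine ⟨fun h a ha b hb => ⟨edist_lt_of_rankOrdering_eq G B h ha hb,
    edist_lt_of_rankOrdering_eq G B h.symm ha hb⟩, fun h => ?_⟩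
  have hmem : ∀ X, X ∈ rankOrdering G B x ↔ X ∈ rankOrdering G B y := by
    intro X
    rw [mem_rankOrdering, mem_rankOrdering]
    refine exists_congr fun b => and_congr_right fun hb => ?_
    have : (B.filter fun c => G.edist x c = G.edist x b)
        = B.filter fun c => G.edist y c = G.edist y b := by
      refine Finset.filter_congr fun c hc => ?_
      -- Equality of two distances is the failure of both strict comparisons, so it transfers as
      -- well.
      have h1 := h c hc b hb
      have h2 := h b hb c hc
      constructor
      · intro e
        refine le_antisymm (not_lt.1 fun hl => ?_) (not_lt.1 fun hl => ?_)
        · exact (h2.2 hl).ne' e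
        · exact (h1.2 hl).ne e
      · intro e
        refine le_antisymm (not_lt.1 fun hl => ?_) (not_lt.1 fun hl => ?_)
        · exact (h2.1 hl).ne' e
        · exact (h1.1 hl).ne e
    rw [this]
  have hne : ∀ z, ∀ X ∈ rankOrdering G B z, ∃ b ∈ B, b ∈ X := by
    intro z X hX
    obtain ⟨b, hb, rfl⟩ := (mem_rankOrdering G B).1 hX
    exact ⟨b, hb, Finset.mem_filter.2 ⟨hb, rfl⟩⟩
  have hsub : ∀ z, ∀ X ∈ rankOrdering G B z, X ⊆ B := by
    intro z X hX
    obtain ⟨b, hb, rfl⟩ := (mem_rankOrdering G B).1 hX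
    exact Finset.filter_subset _ _
  have hnodup : ∀ z, (rankOrdering G B z).Nodup := by
    intro z
    refine ((rankOrdering_pairwise G B z).imp_of_mem ?_)
    rintro X Y hX _ hXY rfl
    obtain ⟨b, _, hb⟩ := hne z X hX
    exact lt_irrefl _ (hXY b hb b hb)
  refine List.Perm.eq_of_pairwise (fun X Y hX hY h1 h2 => ?_) (rankOrdering_pairwise G B x)
    ((rankOrdering_pairwise G B y).imp_of_mem fun {X Y} hX hY hXY a ha b hb =>
      (h a (hsub y X hX ha) b (hsub y Y hY hb)).2 (hXY a ha b hb))
    ((List.perm_ext_iff_of_nodup (hnodup x) (hnodup y)).2 hmem)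
  obtain ⟨a, _, ha⟩ := hne x X hX
  obtain ⟨b, _, hb⟩ := hne y Y hY
  exact absurd (h1 a ha b hb) (h2 b hb a ha).asymm

theorem isCentroidalLocating_iff : IsCentroidalLocating G B ↔ ∀ x y : V, x ≠ y →
    ∃ a ∈ B, ∃ b ∈ B, ¬(G.edist x a < G.edist x b ↔ G.edist y a < G.edist y b) := by
  unfold IsCentroidalLocating
  refine forall_congr' fun x => forall_congr' fun y => forall_congr' fun _ => ?_
  rw [Ne, rankOrdering_eq_iff]
  push Not
  rfl

/-- The pair `{x, y}` itself separates `x` from `y`, as each is closest to itself. Hence the infimum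
defining `centroidalDim` is attained. -/
theorem isCentroidalLocating_univ [Fintype V] : IsCentroidalLocating G Finset.univ := by
  rw [isCentroidalLocating_iff]
  intro x y hxy
  refine ⟨x, Finset.mem_univ _, y, Finset.mem_univ _, fun h => ?_⟩
  have h1 : G.edist x x < G.edist x y := by
    rw [SimpleGraph.edist_self]
    exact SimpleGraph.edist_pos_of_ne hxy
  have h2 := h.1 h1
  rw [SimpleGraph.edist_self] at h2
  exact not_lt_bot h2

theorem exists_card_eq_centroidalDim [Fintype V] :
    ∃ B : Finset V, IsCentroidalLocating G B ∧ B.card = centroidalDim G :=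
  Nat.sInf_mem (s := {k | ∃ B : Finset V, IsCentroidalLocating G B ∧ B.card = k})
    ⟨_, Finset.univ, isCentroidalLocating_univ G, rfl⟩

/-! ### Set covers of the hypergraph of pairs -/

/-- Whichever of the two comparisons is the true one, it supplies the strict inequality of
`Identifies`, and the failing one the weak inequality with the names exchanged. -/
theorem identifies_of_not_iff {q p : VertexPair V} {a b x y : V} (ha : a ∈ q.1) (hb : b ∈ q.1)
    (hx : x ∈ p.1) (hy : y ∈ p.1)
    (h : ¬(G.edist x a < G.edist x b ↔ G.edist y a < G.edist y b)) : Identifies G q p := by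
  by_cases h1 : G.edist x a < G.edist x b
  · have h2 : ¬G.edist y a < G.edist y b := fun h2 => h (iff_of_true h1 h2)
    exact ⟨b, hb, a, ha, y, hy, x, hx, not_lt.1 h2, h1⟩
  · have h2 : G.edist y a < G.edist y b := by
      by_contra h2
      exact h (iff_of_false h1 h2)
    exact ⟨b, hb, a, ha, x, hx, y, hy, not_lt.1 h1, h2⟩

theorem setCoverNumber_pairHypergraph_le [Fintype V] :
    setCoverNumber (pairHypergraph G) ≤ (centroidalDim G).choose 2 := by
  classical
  obtain ⟨B, hB, hcard⟩ := exists_card_eq_centroidalDim G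
  rw [isCentroidalLocating_iff] at hB
  refine Nat.sInf_le ⟨(B.powersetCard 2).subtype fun p => p.card = 2, fun p => ?_, ?_⟩
  · obtain ⟨x, y, hxy, hp⟩ := Finset.card_eq_two.1 p.2
    obtain ⟨a, ha, b, hb, hab⟩ := hB x y hxy
    have hne : a ≠ b := by
      rintro rfl
      exact hab (iff_of_false (lt_irrefl _) (lt_irrefl _))
    refine ⟨⟨{a, b}, Finset.card_pair hne⟩, ?_, ?_⟩
    · rw [Finset.mem_subtype, Finset.mem_powersetCard]
      exact ⟨Finset.insert_subset ha (Finset.singleton_subset_iff.2 hb), Finset.card_pair hne⟩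
    · exact identifies_of_not_iff G (a := a) (b := b) (x := x) (y := y) (by simp) (by simp)
        (by simp [hp]) (by simp [hp]) hab
  · rw [Finset.card_subtype, Finset.filter_true_of_mem, Finset.card_powersetCard, hcard]
    exact fun p hp => (Finset.mem_powersetCard.1 hp).2

theorem isCentroidalLocating_pairUnion [DecidableEq V] {C : Finset (VertexPair V)}
    (hC : IsSetCover (pairHypergraph G) C) : IsCentroidalLocating G (pairUnion C) := by
  rw [isCentroidalLocating_iff]
  intro x y hxy
  obtain ⟨q, hq, b₁, hb₁, b₂, hb₂, x', hx', y', hy', h1, h2⟩ :=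
    hC ⟨{x, y}, Finset.card_pair hxy⟩
  refine ⟨b₂, Finset.mem_biUnion.2 ⟨q, hq, hb₂⟩, b₁, Finset.mem_biUnion.2 ⟨q, hq, hb₁⟩, fun h => ?_⟩
  have h1' := not_lt.2 h1
  simp only [Finset.mem_insert, Finset.mem_singleton] at hx' hy'
  -- `Identifies` does not demand `x' ≠ y'`, but its two inequalities contradict each other if they
  -- coincide.
  rcases hx' with rfl | rfl <;> rcases hy' with rfl | rfl
  · exact h1' h2
  · exact h1' (h.2 h2)
  · exact h1' (h.1 h2)
  · exact h1' h2

theorem card_pairUnion_le [DecidableEq V] (C : Finset (VertexPair V)) :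
    (pairUnion C).card ≤ 2 * C.card := by
  rw [mul_comm]
  exact Finset.card_biUnion_le_card_mul _ _ _ fun q _ => q.2.le

end RankOrdering

/-! ### The approximation algorithm as a command -/

namespace StackProgram

open Finset GreedyCover

@[simp] theorem State.get_at (s : State) (i j k : ℕ) (a : Arr) (u v w : ℕ) :
    (s.at i j k).get a u v w = s.get a u v w := by
  simp [State.at]

theorem State.at_reg (s : State) (i j k : ℕ) (r : Reg) : (s.at i j k).reg r =
    if r = .mid then k else if r = .col then j else if r = .row then i else s.reg r := by
  simp [State.at, State.setReg_reg]

theorem descend_rel {α β : Type*} {n : ℕ} {f : ℕ → α → α} {g : ℕ → β → β} (R : α → β → Prop)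
    (h : ∀ m < n, ∀ x y, R x y → R (f m x) (g m y)) {x : α} {y : β} (hxy : R x y) :
    R (descend n f x) (descend n g y) := by
  induction n generalizing x y with
  | zero => exact hxy
  | succ n ih => exact ih (fun m hm => h m (hm.trans n.lt_succ_self)) (h n n.lt_succ_self x y hxy)

/-- The registers that are not changed after the input has been read. -/
structure Fixed (n L : ℕ) (s : State) : Prop where
  order : s.reg .order = n
  stride : s.reg .stride = n + 1
  size : s.reg .size = L
  zero : s.reg .zero = 0
  out : s.out = []

theorem Fixed.congr {n L : ℕ} {s s' : State} {R : Set Reg} {X : Arr} (h : Fixed n L s)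
    (h' : Agree R X s s') (h1 : Reg.order ∉ R) (h2 : Reg.stride ∉ R) (h3 : Reg.size ∉ R)
    (h4 : Reg.zero ∉ R) : Fixed n L s' :=
  ⟨(h'.reg _ h1).trans h.order, (h'.reg _ h2).trans h.stride, (h'.reg _ h3).trans h.size,
    (h'.reg _ h4).trans h.zero, h'.out.trans h.out⟩

/-- `y` can be reached from `x` in at most `k` steps. -/
def Within (n : ℕ) (adj : ℕ → ℕ → Prop) : ℕ → ℕ → ℕ → Prop
  | 0, x, y => x = y
  | k + 1, x, y => Within n adj k x y ∨ ∃ m < n, Within n adj k x m ∧ adj m y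

/-- The state after the balls of radius `k` have been computed. -/
structure Layer (n L : ℕ) (adj : ℕ → ℕ → Prop) (k : ℕ) (s : State) : Prop extends Fixed n L s where
  adj_iff : ∀ x < n, ∀ y < n, s.get .adj 0 x y = true ↔ adj x y
  ball_iff : ∀ x < n, ∀ y < n, s.get .ball 0 x y = true ↔ Within n adj k x y
  ball'_iff : ∀ x < n, ∀ y < n, s.get .ball' 0 x y = true ↔ Within n adj k x y
  closer_iff : ∀ x < n, ∀ a < n, ∀ b < n, s.get .closer x a b = true ↔
    ∃ j < k, Within n adj j x a ∧ ¬Within n adj j x b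
  cov : s.arr .cov = []
  outArr : s.arr .out = []
  flag : s.arr .flag = []

/-- Compute the balls of radius zero. -/
def Cmd.initBalls : Cmd :=
  .seq (.mark .ball' .zero .row .row .tt)
    (.mark .ball .zero .row .col (.read .ball' .zero .row .col))

/-- Compare the distances of vertices by means of the balls of the current radius. -/
def Cmd.compareBalls : Cmd :=
  .mark .closer .row .col .mid
    (.and (.read .ball .zero .row .col) (.not (.read .ball .zero .row .mid)))

/-- Increase the radius of the balls. -/
def Cmd.growBalls : Cmd :=
  .seq (.mark .ball' .zero .row .col
      (.and (.read .ball .zero .row .mid) (.read .adj .zero .mid .col)))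
    (.mark .ball .zero .row .col (.read .ball' .zero .row .col))

/-! ### Comparison of distances by growing balls -/

section layers

variable {n L : ℕ} {adj : ℕ → ℕ → Prop} {s : State}

theorem layer_initBalls (hf : Fixed n L s)
    (hadj : ∀ x < n, ∀ y < n, s.get .adj 0 x y = true ↔ adj x y)
    (harr : ∀ a ≠ Arr.adj, s.arr a = []) : Layer n L adj 0 (Cmd.initBalls.eval s) := by
  have h1 := marks_mark (X := .ball') (p := .zero) (q := .row) (r := .row) (e := .tt) trivial
    (s := s) (by simp [State.at_reg, hf.order, hf.stride]; omega)
    (by simp [State.at_reg, hf.order, hf.stride]; omega)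
  set s₁ := (Cmd.mark .ball' .zero .row .row .tt).eval s
  have hf₁ : Fixed n L s₁ := hf.congr h1.toAgree (by simp) (by simp) (by simp) (by simp)
  have h2 := marks_mark (X := .ball) (p := .zero) (q := .row) (r := .col)
    (e := .read .ball' .zero .row .col) (by simp [Test.Avoids])
    (s := s₁) (by simp [State.at_reg, hf₁.order, hf₁.stride]; omega)
    (by simp [State.at_reg, hf₁.order, hf₁.stride]; omega)
  have e : Cmd.initBalls.eval s
    = (Cmd.mark .ball .zero .row .col (.read .ball' .zero .row .col)).eval s₁ := rfl
  rw [e]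
  set s₂ := (Cmd.mark .ball .zero .row .col (.read .ball' .zero .row .col)).eval s₁
  have hf₂ : Fixed n L s₂ := hf₁.congr h2.toAgree (by simp) (by simp) (by simp) (by simp)
  have hnil : ∀ {s : State} {a : Arr} (i j k : ℕ), s.arr a = [] → s.get a i j k = false := by
    intro s a i j k h
    simp [State.get, h]
  have b1 : ∀ x < n, ∀ y < n, s₁.get .ball' 0 x y = true ↔ x = y := by
    intro x hx y hy
    rw [h1.get_iff 0 x y (by rw [hf.stride]; omega) (by rw [hf.stride]; omega),
      hnil _ _ _ (harr _ (by simp))]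
    simp only [State.at_reg, hf.order, hf.zero, Test.holds]
    constructor
    · rintro (h | ⟨i, hi, j, hj, k, hk, -, -, h2, h3⟩)
      · simp at h
      · simpa using h2.trans h3.symm
    · rintro rfl
      exact Or.inr ⟨x, hx, x, hx, x, hx, by simp⟩
  have b2 : ∀ x < n, ∀ y < n, s₂.get .ball 0 x y = true ↔ x = y := by
    intro x hx y hy
    rw [h2.get_iff 0 x y (by rw [hf₁.stride]; omega) (by rw [hf₁.stride]; omega),
      hnil _ _ _ ((h1.arr _ (by simp)).trans (harr _ (by simp)))]
    simp only [State.at_reg, hf₁.order, hf₁.zero, Test.holds, State.get_at]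
    constructor
    · rintro (h | ⟨i, hi, j, hj, k, hk, h1, -, h2, h3⟩)
      · simp at h
      · simp at h1 h2 h3
        subst h2 h3
        exact (b1 _ hx _ hy).1 h1
    · rintro rfl
      exact Or.inr ⟨x, hx, x, hx, x, hx, by simpa using b1 x hx x hx⟩
  have hother : ∀ a, a ≠ .ball → a ≠ .ball' → s₂.arr a = s.arr a := fun a ha ha' =>
    (h2.arr a ha).trans (h1.arr a ha')
  refine ⟨hf₂, fun x hx y hy => ?_, b2, fun x hx y hy => ?_, fun x _ a _ b _ => ?_, ?_, ?_, ?_⟩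
  · rw [h2.get (by simp) (by simp), h1.get (by simp) (by simp), hadj x hx y hy]
  · rw [h2.get (by simp) (by simp), b1 x hx y hy]
    rfl
  · rw [hnil _ _ _ ((hother _ (by simp) (by simp)).trans (harr _ (by simp)))]
    simp
  all_goals exact (hother _ (by simp) (by simp)).trans (harr _ (by simp))

/-- Two copies of the balls are kept because `mark` must not read the array it writes: `ball'` grows
from `ball` and is then copied back. Nothing is ever erased, since balls only grow and `closer`
accumulates the radii at which two vertices differ. -/
theorem layer_round {k : ℕ} (h : Layer n L adj k s) :
    Layer n L adj (k + 1) ((Cmd.seq .compareBalls .growBalls).eval s) := by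
  have hf := h.toFixed
  have h1 := marks_mark (X := .closer) (p := .row) (q := .col) (r := .mid)
    (e := .and (.read .ball .zero .row .col) (.not (.read .ball .zero .row .mid)))
    (by simp [Test.Avoids]) (s := s) (by simp [State.at_reg, hf.order, hf.stride]; omega)
    (by simp [State.at_reg, hf.order, hf.stride]; omega)
  have e₁ : (Cmd.mark .closer .row .col .mid
    (.and (.read .ball .zero .row .col) (.not (.read .ball .zero .row .mid)))).eval s
      = Cmd.compareBalls.eval s := rfl
  rw [e₁] at h1
  set s₁ := Cmd.compareBalls.eval s
  have hf₁ : Fixed n L s₁ := hf.congr h1.toAgree (by simp) (by simp) (by simp) (by simp)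
  have h2 := marks_mark (X := .ball') (p := .zero) (q := .row) (r := .col)
    (e := .and (.read .ball .zero .row .mid) (.read .adj .zero .mid .col))
    (by simp [Test.Avoids]) (s := s₁) (by simp [State.at_reg, hf₁.order, hf₁.stride]; omega)
    (by simp [State.at_reg, hf₁.order, hf₁.stride]; omega)
  set s₂ := (Cmd.mark .ball' .zero .row .col
    (.and (.read .ball .zero .row .mid) (.read .adj .zero .mid .col))).eval s₁
  have hf₂ : Fixed n L s₂ := hf₁.congr h2.toAgree (by simp) (by simp) (by simp) (by simp)
  have h3 := marks_mark (X := .ball) (p := .zero) (q := .row) (r := .col)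
    (e := .read .ball' .zero .row .col) (by simp [Test.Avoids])
    (s := s₂) (by simp [State.at_reg, hf₂.order, hf₂.stride]; omega)
    (by simp [State.at_reg, hf₂.order, hf₂.stride]; omega)
  have e : (Cmd.seq .compareBalls .growBalls).eval s
    = (Cmd.mark .ball .zero .row .col (.read .ball' .zero .row .col)).eval s₂ := rfl
  rw [e]
  set s₃ := (Cmd.mark .ball .zero .row .col (.read .ball' .zero .row .col)).eval s₂
  have hf₃ : Fixed n L s₃ := hf₂.congr h3.toAgree (by simp) (by simp) (by simp) (by simp)
  have c1 : ∀ x < n, ∀ a < n, ∀ b < n, s₁.get .closer x a b = true ↔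
      ∃ j < k + 1, Within n adj j x a ∧ ¬Within n adj j x b := by
    intro x hx a ha b hb
    rw [h1.get_iff x a b (by rw [hf.stride]; omega) (by rw [hf.stride]; omega),
      h.closer_iff x hx a ha b hb]
    simp only [State.at_reg, hf.order, hf.zero, Test.holds, State.get_at]
    constructor
    · rintro (⟨j, hj, hab⟩ | ⟨i, hi, j, hj, m, hm, hh, e1, e2, e3⟩)
      · exact ⟨j, by omega, hab⟩
      · simp at hh e1 e2 e3
        subst e1 e2 e3
        refine ⟨k, by omega, (h.ball_iff _ hx _ ha).1 hh.1, fun hw => ?_⟩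
        rw [(h.ball_iff _ hx _ hb).2 hw] at hh
        simp at hh
    · rintro ⟨j, hj, hab⟩
      rcases (Nat.lt_succ_iff.1 hj).lt_or_eq with hj | rfl
      · exact Or.inl ⟨j, hj, hab⟩
      · refine Or.inr ⟨x, hx, a, ha, b, hb, ?_⟩
        simp [(h.ball_iff _ hx _ ha).2 hab.1, Bool.eq_false_iff.2
            (mt (h.ball_iff _ hx _ hb).1 hab.2)]
  have b2 : ∀ x < n, ∀ y < n, s₂.get .ball' 0 x y = true ↔ Within n adj (k + 1) x y := by
    intro x hx y hy
    rw [h2.get_iff 0 x y (by rw [hf₁.stride]; omega) (by rw [hf₁.stride]; omega),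
      h1.get (by simp) (by simp), h.ball'_iff x hx y hy, Within]
    refine or_congr_right ?_
    simp only [State.at_reg, hf₁.order, hf₁.zero, Test.holds, State.get_at]
    constructor
    · rintro ⟨i, hi, j, hj, m, hm, hh, -, e2, e3⟩
      simp at hh e2 e3
      subst e2 e3
      rw [h1.get (by simp) (by simp), h1.get (by simp) (by simp)] at hh
      exact ⟨m, hm, (h.ball_iff _ hx _ hm).1 hh.1, (h.adj_iff _ hm _ hy).1 hh.2⟩
    · rintro ⟨m, hm, hw, ha⟩
      refine ⟨x, hx, y, hy, m, hm, ?_⟩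
      simp only [if_true, reduceCtorEq, if_false]
      rw [h1.get (by simp) (by simp), h1.get (by simp) (by simp), (h.ball_iff _ hx _ hm).2 hw,
        (h.adj_iff _ hm _ hy).2 ha]
      simp
  have b3 : ∀ x < n, ∀ y < n, s₃.get .ball 0 x y = true ↔ Within n adj (k + 1) x y := by
    intro x hx y hy
    rw [h3.get_iff 0 x y (by rw [hf₂.stride]; omega) (by rw [hf₂.stride]; omega),
      h2.get (by simp) (by simp), h1.get (by simp) (by simp), h.ball_iff x hx y hy]
    simp only [State.at_reg, hf₂.order, hf₂.zero, Test.holds, State.get_at]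
    constructor
    · rintro (hw | ⟨i, hi, j, hj, m, hm, hh, -, e2, e3⟩)
      · exact Or.inl hw
      · simp at hh e2 e3
        subst e2 e3
        exact (b2 _ hx _ hy).1 hh
    · intro hw
      exact Or.inr ⟨x, hx, y, hy, x, hx, by simpa using (b2 x hx y hy).2 hw⟩
  have hother : ∀ a, a ≠ .ball → a ≠ .ball' → a ≠ .closer → s₃.arr a = s.arr a :=
      fun a ha ha' ha'' =>
    (h3.arr a ha).trans ((h2.arr a ha').trans (h1.arr a ha''))
  refine ⟨hf₃, fun x hx y hy => ?_, b3, fun x hx y hy => ?_, fun x hx a ha b hb => ?_, ?_, ?_, ?_⟩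
  · rw [h3.get (by simp) (by simp), h2.get (by simp) (by simp), h1.get (by simp) (by simp),
      h.adj_iff x hx y hy]
  · rw [h3.get (by simp) (by simp), b2 x hx y hy]
  · rw [h3.get (by simp) (by simp), h2.get (by simp) (by simp), c1 x hx a ha b hb]
  · exact (hother _ (by simp) (by simp) (by simp)).trans h.cov
  · exact (hother _ (by simp) (by simp) (by simp)).trans h.outArr
  · exact (hother _ (by simp) (by simp) (by simp)).trans h.flag

theorem Layer.setReg_rnd {k : ℕ} (h : Layer n L adj k s) (m : ℕ) :
    Layer n L adj k (s.setReg .rnd m) := by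
  have hf := h.toFixed.congr (Agree.setReg (v := .rnd) {.rnd} .adj s (by simp) m) (by simp)
      (by simp)
    (by simp) (by simp)
  exact ⟨hf, by simpa using h.adj_iff, by simpa using h.ball_iff, by simpa using h.ball'_iff,
    by simpa using h.closer_iff, h.cov, h.outArr, h.flag⟩

/-- Compare all distances. -/
def Cmd.compareAll : Cmd :=
  .seq .initBalls (.forDown .rnd .order (.seq .compareBalls .growBalls))

theorem layer_compareAll (hf : Fixed n L s)
    (hadj : ∀ x < n, ∀ y < n, s.get .adj 0 x y = true ↔ adj x y)
    (harr : ∀ a ≠ Arr.adj, s.arr a = []) : Layer n L adj n (Cmd.compareAll.eval s) := by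
  have h0 := layer_initBalls hf hadj harr
  -- The loop register counts down, so the radius reached is `n - m`.
  have key := descend_invariant (n := n)
    (f := fun m s => (Cmd.seq .compareBalls .growBalls).eval (s.setReg .rnd m))
    (x := Cmd.initBalls.eval s) (fun m s => Layer n L adj (n - m) s) (by simpa using h0)
    fun m hm s' hs' => by
      have := layer_round (hs'.setReg_rnd m)
      rwa [show n - (m + 1) + 1 = n - m by omega] at this
  have e : Cmd.compareAll.eval s = descend n
      (fun m s => (Cmd.seq .compareBalls .growBalls).eval (s.setReg .rnd m))
      (Cmd.initBalls.eval s) := by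
    rw [Cmd.compareAll, Cmd.eval, Cmd.eval, h0.order]
  rw [e]
  exact key

end layers

end StackProgram

/-! ### The greedy cover as a command -/

namespace StackProgram

open Finset GreedyCover

/-- The pairs of vertices that the comparison of the distances to `q.1` and to `q.2` separates. -/
def separated (n : ℕ) (lt : ℕ → ℕ → ℕ → Bool) (q : ℕ × ℕ) : Finset (ℕ × ℕ) :=
  (range n ×ˢ range n).filter fun p => lt p.1 q.1 q.2 ≠ lt p.2 q.1 q.2

theorem mem_separated {n : ℕ} {lt : ℕ → ℕ → ℕ → Bool} {q p : ℕ × ℕ} :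
    p ∈ separated n lt q ↔ (p.1 < n ∧ p.2 < n) ∧ lt p.1 q.1 q.2 ≠ lt p.2 q.1 q.2 := by
  simp [separated]

/-- The state represents the partial cover `C`. -/
structure Represents (n L : ℕ) (lt : ℕ → ℕ → ℕ → Bool) (C : Finset (ℕ × ℕ)) (s : State) : Prop
    extends Fixed n L s where
  closer : ∀ x < n, ∀ a < n, ∀ b < n, s.get .closer x a b = lt x a b
  cov_iff : ∀ x < n, ∀ y < n, s.get .cov 0 x y = true ↔ (x, y) ∈ covered (separated n lt) C
  outArr_iff : ∀ v < n, s.get .out 0 0 v = true ↔ ∃ q ∈ C, q.1 = v ∨ q.2 = v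
  flag : s.get .flag 0 0 0 = false

/-- The test whether the current pair of vertices separates the pair in the loop registers. -/
def Test.separates : Test := .differ (.read .closer .row .fst .snd) (.read .closer .col .fst .snd)

/-- Add the current pair of vertices to the cover. -/
def Cmd.pick : Cmd :=
  .seq (.write .out .zero .zero .fst true) (.seq (.write .out .zero .zero .snd true)
    (.seq (.mark .cov .zero .row .col .separates) (.write .flag .zero .zero .zero false)))

/-- One step of the greedy algorithm. -/
def Cmd.greedyStep : Cmd :=
  .seq (.copy .cnt .thr) (.seq (.count (.and (.not (.read .cov .zero .row .col)) .separates))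
    (.cond (.read .flag .zero .zero .zero) .pick .skip))

section greedy

variable {n L : ℕ} {lt : ℕ → ℕ → ℕ → Bool} {C : Finset (ℕ × ℕ)} {s : State} {a b t : ℕ}

theorem Represents.setReg (h : Represents n L lt C s) {v : Reg} (h1 : v ≠ .order)
    (h2 : v ≠ .stride) (h3 : v ≠ .size) (h4 : v ≠ .zero) (m : ℕ) :
    Represents n L lt C (s.setReg v m) :=
  ⟨h.toFixed.congr (Agree.setReg (v := v) {v} .adj s (by simp) m) (by simpa using h1.symm)
    (by simpa using h2.symm) (by simpa using h3.symm) (by simpa using h4.symm),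
    by simpa [h2] using h.closer, by simpa [h2] using h.cov_iff, by simpa [h2] using h.outArr_iff,
    by simpa [h2] using h.flag⟩

/-- The parts of `Represents` are assumed separately because `flag` is set when a pair is picked;
the last write clears it again. -/
theorem represents_pick (hf : Fixed n L s)
    (hcloser : ∀ x < n, ∀ a < n, ∀ b < n, s.get .closer x a b = lt x a b)
    (hcov : ∀ x < n, ∀ y < n, s.get .cov 0 x y = true ↔ (x, y) ∈ covered (separated n lt) C)
    (hout : ∀ v < n, s.get .out 0 0 v = true ↔ ∃ q ∈ C, q.1 = v ∨ q.2 = v)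
    (ha : a < n) (hb : b < n) (hfst : s.reg .fst = a) (hsnd : s.reg .snd = b) :
    Represents n L lt (insert (a, b) C) (Cmd.pick.eval s) ∧
      ∀ r, r ≠ .row → r ≠ .col → r ≠ .mid → (Cmd.pick.eval s).reg r = s.reg r := by
  have hst : ∀ {m}, m < n → m < s.reg .stride := by rw [hf.stride]; intro m hm; omega
  have hst0 : 0 < s.reg .stride := by rw [hf.stride]; omega
  have A1 : Agree ∅ .out s ((Cmd.write .out .zero .zero .fst true).eval s) := Agree.setArr _ _ _ _
  have g1 := fun v (hv : v < n) => get_write s .out .zero .zero .fst true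
      (by rw [hf.zero]; exact hst0)
    (by rw [hfst]; exact hst ha) (i := 0) (j := 0) (k := v) hst0 (hst hv)
  set s₁ := (Cmd.write .out .zero .zero .fst true).eval s
  have hf₁ := hf.congr A1 (by simp) (by simp) (by simp) (by simp)
  have hsnd₁ : s₁.reg .snd = b := hsnd
  have A2 : Agree ∅ .out s₁ ((Cmd.write .out .zero .zero .snd true).eval s₁) := Agree.setArr _ _ _ _
  have g2 := fun v (hv : v < n) => get_write s₁ .out .zero .zero .snd true
    (by rw [hf₁.zero]; exact hst0)
    (by rw [hsnd₁]; exact hst hb) (i := 0) (j := 0) (k := v) hst0 (hst hv)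
  set s₂ := (Cmd.write .out .zero .zero .snd true).eval s₁
  have hf₂ := hf₁.congr A2 (by simp) (by simp) (by simp) (by simp)
  have A3 := marks_mark (X := .cov) (p := .zero) (q := .row) (r := .col) (e := .separates)
    (by simp [Test.Avoids, Test.separates]) (s := s₂)
    (by simp [State.at_reg, hf₂.order, hf₂.stride]; omega)
    (by simp [State.at_reg, hf₂.order, hf₂.stride]; omega)
  set s₃ := (Cmd.mark .cov .zero .row .col .separates).eval s₂
  have hf₃ := hf₂.congr A3.toAgree (by simp) (by simp) (by simp) (by simp)
  have hst₃ : 0 < s₃.reg .stride := by rw [hf₃.stride]; omega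
  have A4 : Agree ∅ .flag s₃ ((Cmd.write .flag .zero .zero .zero false).eval s₃) :=
    Agree.setArr _ _ _ _
  have g4 := get_write s₃ .flag .zero .zero .zero false
    (by rw [hf₃.zero]; exact hst₃) (by rw [hf₃.zero]; exact hst₃) (i := 0) hst₃ hst₃
  have e : Cmd.pick.eval s = (Cmd.write .flag .zero .zero .zero false).eval s₃ := rfl
  rw [e]
  set s₄ := (Cmd.write .flag .zero .zero .zero false).eval s₃
  have hf₄ := hf₃.congr A4 (by simp) (by simp) (by simp) (by simp)
  have hreg₂ : s₂.reg = s.reg := rfl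
  have hcl₂ : ∀ i j k, s₂.get .closer i j k = s.get .closer i j k := fun i j k =>
    (A2.get (by simp) (by simp) i j k).trans (A1.get (by simp) (by simp) i j k)
  refine ⟨⟨hf₄, fun x hx u hu v hv => ?_, fun x hx y hy => ?_, fun v hv => ?_, ?_⟩, ?_⟩
  · rw [A4.get (by simp) (by simp), A3.get (by simp) (by simp), hcl₂, hcloser x hx u hu v hv]
  · rw [A4.get (by simp) (by simp), A3.get_iff 0 x y (hst hx) (hst hy), A2.get (by simp) (by simp),
      A1.get (by simp) (by simp), hcov x hx y hy]
    simp only [State.at_reg, hf₂.order, hf₂.zero, Test.holds, State.get_at, Test.separates, hcl₂,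
      reduceCtorEq, if_false, if_true, hreg₂, hfst, hsnd]
    simp only [covered, biUnion_insert, mem_union]
    rw [or_comm]
    refine or_congr_left ?_
    rw [mem_separated]
    constructor
    · rintro ⟨i, hi, j, hj, -, -, hh, -, rfl, rfl⟩
      refine ⟨⟨hx, hy⟩, ?_⟩
      rw [hcloser _ hx a ha b hb, hcloser _ hy a ha b hb] at hh
      simpa using hh
    · rintro ⟨-, hh⟩
      refine ⟨x, hx, y, hy, x, hx, ?_, trivial, rfl, rfl⟩
      rw [hcloser _ hx a ha b hb, hcloser _ hy a ha b hb]
      simpa using hh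
  · rw [A4.get (by simp) (by simp), A3.get (by simp) (by simp), g2 v hv, g1 v hv]
    simp only [hf₁.zero, hf.zero, hfst, hsnd₁, true_and]
    have h0 := hout v hv
    by_cases h1 : v = b
    · simp [h1]
    · by_cases h2 : v = a
      · simp [h2]
      · simp [h1, h2, h0, Ne.symm h1, Ne.symm h2]
  · rw [g4]
    simp [hf₃.zero]
  · intro r h1 h2 h3
    rw [A4.reg r (by simp), A3.reg r (by simp [h1, h2, h3]), hreg₂]

/-- Counting from `cnt = t` over the uncovered pairs that `(a, b)` separates sets `flag` exactly
when there are more than `t` of them, which is the greedy condition. -/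
theorem represents_greedyStep (h : Represents n L lt C s) (ha : a < n) (hb : b < n)
    (hfst : s.reg .fst = a) (hsnd : s.reg .snd = b) (hthr : s.reg .thr = t) :
    Represents n L lt (GreedyCover.greedyStep (separated n lt) t (a, b) C)
        (Cmd.greedyStep.eval s) ∧
      (Cmd.greedyStep.eval s).reg .thr = t ∧ (Cmd.greedyStep.eval s).reg .fst = a := by
  have h1 := h.setReg (v := .cnt) (by simp) (by simp) (by simp) (by simp) t
  set s₁ := s.setReg .cnt t with hs₁
  have hf₁ := h1.toFixed
  have hr₁ : s₁.reg .fst = a ∧ s₁.reg .snd = b ∧ s₁.reg .thr = t := by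
    simp [hs₁, State.setReg_reg, hfst, hsnd, hthr]
  have hc := counts_count (e := .and (.not (.read .cov .zero .row .col)) .separates)
    (by simp [Test.Avoids, Test.separates]) hf₁.zero (by rw [hf₁.stride]; omega)
    (fun s c => by simp [Test.holds, Test.separates, State.setReg_reg])
  have hsum : (∑ i ∈ range (s₁.reg .order), ∑ j ∈ range (s₁.reg .order),
      if (Test.and (.not (.read .cov .zero .row .col)) .separates).holds
        ((s₁.setReg .row i).setReg .col j) = true then 1 else 0)
      = #(separated n lt (a, b) \ covered (separated n lt) C) := by
    have e1 : separated n lt (a, b) \ covered (separated n lt) C = (range n ×ˢ range n).filter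
        fun p => (Test.and (.not (.read .cov .zero .row .col)) .separates).holds
        ((s₁.setReg .row p.1).setReg .col p.2) = true := by
      ext ⟨x, y⟩
      rw [mem_sdiff, mem_separated, mem_filter, mem_product, mem_range, mem_range, and_assoc]
      refine and_congr_right fun hxy => ?_
      have hx : x < n := hxy.1
      have hy : y < n := hxy.2
      simp only [Test.holds, Test.separates, State.setReg_reg, ne_eq, reduceCtorEq,
        not_false_eq_true, State.get_setReg, if_false, if_true, hf₁.zero, hr₁.1, hr₁.2.1,
        h1.closer x hx a ha b hb, h1.closer y hy a ha b hb, ← h1.cov_iff x hx y hy]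
      simp [and_comm]
    rw [e1, card_filter, sum_product, hf₁.order]
  rw [hsum] at hc
  set s₂ := (Cmd.count (.and (.not (.read .cov .zero .row .col)) .separates)).eval s₁
  have hf₂ := hf₁.congr hc.toAgree (by simp) (by simp) (by simp) (by simp)
  have hr₂ : s₂.reg .fst = a ∧ s₂.reg .snd = b ∧ s₂.reg .thr = t := by
    rw [hc.reg _ (by simp), hc.reg _ (by simp), hc.reg _ (by simp)]
    exact hr₁
  have hflag : s₂.get .flag 0 0 0 = true ↔
      t < #(separated n lt (a, b) \ covered (separated n lt) C) := by
    rw [hc.flag, h1.flag]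
    simp [hs₁]
  have e : Cmd.greedyStep.eval s
      = (Cmd.cond (.read .flag .zero .zero .zero) .pick .skip).eval s₂ := by
    simp only [Cmd.greedyStep, Cmd.eval, hthr]
    rfl
  have hcl : ∀ x < n, ∀ a < n, ∀ b < n, s₂.get .closer x a b = lt x a b := fun x hx u hu v hv => by
    rw [hc.get (by simp) (by simp), h1.closer x hx u hu v hv]
  have hcov : ∀ x < n, ∀ y < n, s₂.get .cov 0 x y = true ↔ (x, y) ∈ covered (separated n lt) C :=
    fun x hx y hy => by rw [hc.get (by simp) (by simp), h1.cov_iff x hx y hy]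
  have hout : ∀ v < n, s₂.get .out 0 0 v = true ↔ ∃ q ∈ C, q.1 = v ∨ q.2 = v := fun v hv => by
    rw [hc.get (by simp) (by simp), h1.outArr_iff v hv]
  have e2 : (Test.read .flag .zero .zero .zero).holds s₂ = s₂.get .flag 0 0 0 := by
    simp [Test.holds, hf₂.zero]
  rw [e, Cmd.eval_cond, e2]
  unfold GreedyCover.greedyStep
  by_cases hlt : t < #(separated n lt (a, b) \ covered (separated n lt) C)
  · rw [if_pos (hflag.2 hlt), if_pos hlt]
    have hp := represents_pick hf₂ hcl hcov hout ha hb hr₂.1 hr₂.2.1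
    refine ⟨hp.1, ?_, ?_⟩
    · rw [hp.2 _ (by simp) (by simp) (by simp), hr₂.2.2]
    · rw [hp.2 _ (by simp) (by simp) (by simp), hr₂.1]
  · rw [if_neg (mt hflag.1 hlt), if_neg hlt]
    exact ⟨⟨hf₂, hcl, hcov, hout, by simpa [Cmd.eval] using mt hflag.1 hlt⟩, hr₂.2.2, hr₂.1⟩

/-- The greedy algorithm. -/
def Cmd.greedy : Cmd :=
  .forDown .thr .size (.forDown .fst .order (.forDown .snd .order .greedyStep))

/-- A simulation: the three loops of the command mirror those of `GreedyCover.greedy`, and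
`descend_rel` carries the representation through each. The relation also remembers the outer loop
registers. -/
theorem represents_greedy (h : Represents n L lt ∅ s) :
    Represents n L lt (GreedyCover.greedy (separated n lt) n L) (Cmd.greedy.eval s) := by
  have e : Cmd.greedy.eval s = descend L (fun m s =>
      (Cmd.forDown .fst .order (.forDown .snd .order .greedyStep)).eval (s.setReg .thr m)) s := by
    rw [Cmd.greedy, Cmd.eval, h.size]
  rw [e]
  refine descend_rel (fun s C => Represents n L lt C s) (fun t _ s C hs => ?_) h
  have hs' := hs.setReg (v := .thr) (by simp) (by simp) (by simp) (by simp) t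
  have ht : (s.setReg .thr t).reg .thr = t := by simp
  generalize s.setReg .thr t = s at hs' ht
  rw [Cmd.eval, hs'.order]
  refine (descend_rel (fun s C => Represents n L lt C s ∧ s.reg .thr = t)
    (fun a ha s C hs => ?_) ⟨hs', ht⟩).1
  have hs' := hs.1.setReg (v := .fst) (by simp) (by simp) (by simp) (by simp) a
  have ht : (s.setReg .fst a).reg .thr = t := by simpa [State.setReg_reg] using hs.2
  have hf : (s.setReg .fst a).reg .fst = a := by simp
  generalize s.setReg .fst a = s at hs' ht hf
  rw [Cmd.eval, hs'.order]
  have key := descend_rel (n := n) (f := fun m s => Cmd.greedyStep.eval (s.setReg .snd m))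
    (g := fun b C => GreedyCover.greedyStep (separated n lt) t (a, b) C)
    (fun s C => Represents n L lt C s ∧ s.reg .thr = t ∧ s.reg .fst = a)
    (fun b hb s C hs => ?_) ⟨hs', ht, hf⟩
  · exact ⟨key.1, key.2.1⟩
  · exact represents_greedyStep (hs.1.setReg (by simp) (by simp) (by simp) (by simp) b) ha hb
      (by simpa [State.setReg_reg] using hs.2.2) (by simp)
      (by simpa [State.setReg_reg] using hs.2.1)

/-- Write the result to the output. -/
def Cmd.emitAll : Cmd :=
  .forDown .row .order (.cond (.read .out .zero .zero .row) (.emit true) (.emit false))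

theorem out_emitAll (hf : Fixed n L s) :
    (Cmd.emitAll.eval s).out = (List.range n).map fun v => s.get .out 0 0 v := by
  have e : Cmd.emitAll.eval s = descend n (fun m s =>
      (Cmd.cond (.read .out .zero .zero .row) (.emit true) (.emit false)).eval
        (s.setReg .row m)) s := by
    rw [Cmd.emitAll, Cmd.eval, hf.order]
  -- Indices decrease while bits are pushed in front, so the output is in increasing order.
  rw [e, ← List.Ico.zero_bot]
  refine (descend_invariant (fun m (s' : State) =>
    s'.out = (List.Ico m n).map (fun v => s.get .out 0 0 v) ∧
    (∀ r, r ≠ .row → s'.reg r = s.reg r) ∧ s'.arr = s.arr) ?_ ?_).1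
  · exact ⟨by simp [hf.out], fun _ _ => rfl, rfl⟩
  · rintro m hm s' ⟨h1, h2, h3⟩
    rw [Cmd.eval_cond]
    have e1 : (Test.read .out .zero .zero .row).holds (s'.setReg .row m) = s.get .out 0 0 m := by
      simp [Test.holds, State.setReg_reg, State.get, h2, h3, hf.zero]
    rw [e1, List.Ico.eq_cons hm, List.map_cons]
    have h2' : ∀ r, r ≠ .row → (s'.setReg .row m).reg r = s.reg r := fun r hr => by
      rw [State.setReg_reg, if_neg hr, h2 r hr]
    split
    · rename_i hh
      exact ⟨by simp [Cmd.eval, h1, hh], h2', h3⟩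
    · rename_i hh
      exact ⟨by simp [Cmd.eval, h1, Bool.eq_false_iff.2 hh], h2', h3⟩

/-- The approximation algorithm for Centroidal Dimension. -/
def Cmd.centroidal : Cmd := .seq .compareAll (.seq .greedy .emitAll)

theorem out_centroidal {adj : ℕ → ℕ → Prop} (hf : Fixed n L s)
    (hadj : ∀ x < n, ∀ y < n, s.get .adj 0 x y = true ↔ adj x y)
    (harr : ∀ a ≠ Arr.adj, s.arr a = [])
    (hlt : ∀ x < n, ∀ a < n, ∀ b < n, lt x a b = true ↔
      ∃ j < n, Within n adj j x a ∧ ¬Within n adj j x b) :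
    (Cmd.centroidal.eval s).out = (List.range n).map fun v =>
      decide (∃ q ∈ GreedyCover.greedy (separated n lt) n L, q.1 = v ∨ q.2 = v) := by
  have h1 := layer_compareAll hf hadj harr
  have h2 : Represents n L lt ∅ (Cmd.compareAll.eval s) := by
    refine ⟨h1.toFixed, fun x hx a ha b hb => ?_, ?_, ?_, ?_⟩
    · rw [Bool.eq_iff_iff, h1.closer_iff x hx a ha b hb, hlt x hx a ha b hb]
    · simp [State.get, h1.cov, covered]
    · simp [State.get, h1.outArr]
    · simp [State.get, h1.flag]
  have h3 := represents_greedy h2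
  rw [Cmd.centroidal, Cmd.eval, Cmd.eval, out_emitAll h3.toFixed]
  refine List.map_congr_left fun v hv => ?_
  rw [Bool.eq_iff_iff, h3.outArr_iff v (List.mem_range.1 hv), decide_eq_true_iff]

end greedy

end StackProgram

/-! ### Distances in graphs on an initial segment -/

namespace CentroidalGreedy

open StackProgram Finset

variable {n : ℕ}

/-- Adjacency of numbers that are vertices. -/
def AdjNat (G : SimpleGraph (Fin n)) (x y : ℕ) : Prop :=
  ∃ (hx : x < n) (hy : y < n), G.Adj ⟨x, hx⟩ ⟨y, hy⟩

theorem exists_adj_of_edist_eq_succ {V : Type*} {G : SimpleGraph V} {x y : V} {k : ℕ}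
    (h : G.edist x y = (k + 1 : ℕ)) : ∃ z, G.edist x z ≤ k ∧ G.Adj z y := by
  obtain ⟨p, hp⟩ := SimpleGraph.exists_walk_of_edist_eq_coe h
  have hn : ¬p.Nil := by
    rw [SimpleGraph.Walk.not_nil_iff_lt_length]
    omega
  refine ⟨p.penultimate, ?_, p.adj_penultimate hn⟩
  refine (SimpleGraph.edist_le p.dropLast).trans ?_
  have : p.dropLast.length ≤ k := by
    simp [hp]
  exact_mod_cast this

/-- One more step is the triangle inequality in one direction and, in the other, the penultimate
vertex of a shortest walk. -/
theorem within_adjNat_iff (G : SimpleGraph (Fin n)) (k : ℕ) (x y : Fin n) :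
    Within n (AdjNat G) k x y ↔ G.edist x y ≤ k := by
  induction k generalizing y with
  | zero => simp [Within, SimpleGraph.edist_eq_zero_iff, Fin.ext_iff]
  | succ k ih =>
    rw [Within, ih]
    constructor
    · rintro (h | ⟨m, hm, h1, _, _, h2⟩)
      · exact h.trans (by exact_mod_cast k.le_succ)
      · have h1' := (ih ⟨m, hm⟩).1 h1
        refine (SimpleGraph.edist_triangle (v := ⟨m, hm⟩)).trans ?_
        rw [SimpleGraph.edist_eq_one_iff_adj.2 h2, Nat.cast_succ]
        exact add_le_add_left h1' 1
    · intro h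
      rcases h.lt_or_eq with h | h
      · exact Or.inl (Order.le_of_lt_add_one (by exact_mod_cast h))
      · obtain ⟨z, h1, h2⟩ := exists_adj_of_edist_eq_succ h
        exact Or.inr ⟨z, z.2, (ih z).2 h1, z.2, y.2, h2⟩

theorem exists_edist_eq_coe {V : Type*} [Fintype V] {G : SimpleGraph V} {x y : V}
    (h : G.edist x y ≠ ⊤) : ∃ k < Fintype.card V, G.edist x y = k := by
  have hr := SimpleGraph.reachable_of_edist_ne_top h
  obtain ⟨p, hp, hl⟩ := hr.exists_path_of_dist
  exact ⟨G.dist x y, hl ▸ hp.length_lt, hr.coe_dist_eq_edist.symm⟩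

/-- The radius `d(x,a)` works: it is finite, being smaller than another distance, and below the
number of vertices because shortest paths do not repeat vertices. An infinite `d(x,b)` needs no
separate treatment. -/
theorem edist_lt_iff_exists {V : Type*} [Fintype V] {G : SimpleGraph V} {x a b : V} :
    G.edist x a < G.edist x b ↔
      ∃ j < Fintype.card V, G.edist x a ≤ (j : ℕ) ∧ ¬G.edist x b ≤ (j : ℕ) := by
  constructor
  · intro h
    obtain ⟨k, hk, e⟩ := exists_edist_eq_coe h.ne_top
    exact ⟨k, hk, e.le, not_le.2 (e ▸ h)⟩
  · rintro ⟨j, -, h1, h2⟩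
    exact h1.trans_lt (not_le.1 h2)

open Classical in
/-- Whether `a` is closer to `x` than `b`. -/
noncomputable def closer (G : SimpleGraph (Fin n)) (x a b : ℕ) : Bool :=
  decide (∃ (hx : x < n) (ha : a < n) (hb : b < n),
    G.edist ⟨x, hx⟩ ⟨a, ha⟩ < G.edist ⟨x, hx⟩ ⟨b, hb⟩)

theorem closer_iff (G : SimpleGraph (Fin n)) (x a b : Fin n) :
    closer G x a b = true ↔ G.edist x a < G.edist x b := by
  simp [closer]

theorem closer_iff_within (G : SimpleGraph (Fin n)) {x a b : ℕ} (hx : x < n) (ha : a < n)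
    (hb : b < n) : closer G x a b = true ↔
      ∃ j < n, Within n (AdjNat G) j x a ∧ ¬Within n (AdjNat G) j x b := by
  have h1 := closer_iff G ⟨x, hx⟩ ⟨a, ha⟩ ⟨b, hb⟩
  simp only [edist_lt_iff_exists, ← within_adjNat_iff, Fintype.card_fin] at h1
  exact h1

/-! ### Adjacency matrices -/

theorem getElem?_flatMap_of_length {α β : Type*} {f : α → List β} {w : ℕ}
    (hw : ∀ a, (f a).length = w)
    (l : List α) (i : ℕ) {j : ℕ} (hj : j < w) :
    (l.flatMap f)[i * w + j]? = l[i]?.bind fun a => (f a)[j]? := by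
  induction l generalizing i with
  | nil => simp
  | cons a l ih =>
    rw [List.flatMap_cons]
    cases i with
    | zero => rw [List.getElem?_append_left (by rw [hw]; omega)]; simp
    | succ i =>
      have e : (i + 1) * w + j - w = i * w + j := by rw [Nat.succ_mul]; omega
      rw [List.getElem?_append_right (by rw [hw, Nat.succ_mul]; omega), hw, e, ih]
      simp

theorem length_encodeGraph (G : SimpleGraph (Fin n)) : (encodeGraph ⟨n, G⟩).length =
    n * (n + 1) := by
  simp [encodeGraph, List.length_flatMap]

theorem count_none_encodeGraph (G : SimpleGraph (Fin n)) : (encodeGraph ⟨n, G⟩).count none = n := by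
  have h : ∀ l : List (Fin n), ∀ f : Fin n → Bool, (l.map fun j => some (f j)).count none = 0 := by
    intro l f
    rw [List.count_eq_zero]
    simp
  simp [encodeGraph, List.count_flatMap, Function.comp_def, h]

open Classical in
theorem getElem?_encodeGraph (G : SimpleGraph (Fin n)) (x y : Fin n) :
    (encodeGraph ⟨n, G⟩)[(x : ℕ) * (n + 1) + y]? = some (some (decide (G.Adj x y))) := by
  rw [encodeGraph, getElem?_flatMap_of_length (w := n + 1) (by simp) _ _ (y.2.trans n.lt_succ_self)]
  simp

theorem fixed_init (G : SimpleGraph (Fin n)) :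
    Fixed n (n * (n + 1)) (State.init (encodeGraph ⟨n, G⟩)) :=
  ⟨count_none_encodeGraph G, congrArg (· + 1) (count_none_encodeGraph G), length_encodeGraph G, rfl,
    rfl⟩

/-- No decoding is needed: with separators read as `false`, the input word is a matrix with rows of
length `n + 1`, which is the stride. -/
theorem get_adj_init (G : SimpleGraph (Fin n)) {x y : ℕ} (hx : x < n) (hy : y < n) :
    (State.init (encodeGraph ⟨n, G⟩)).get .adj 0 x y = true ↔ AdjNat G x y := by
  have h := getElem?_encodeGraph G ⟨x, hx⟩ ⟨y, hy⟩
  simp only at h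
  rw [State.get, (fixed_init G).stride]
  simp [State.init, List.getD_eq_getElem?_getD, h, AdjNat, hx, hy]

/-! ### The approximation algorithm -/

/-- The pairs picked by the greedy algorithm. -/
noncomputable def picked (G : SimpleGraph (Fin n)) : Finset (ℕ × ℕ) :=
  GreedyCover.greedy (separated n (closer G)) n (n * (n + 1))

open Classical in
/-- The vertices picked by the greedy algorithm. -/
noncomputable def solution (n : ℕ) (G : SimpleGraph (Fin n)) : Finset (Fin n) :=
  univ.filter fun v => ∃ q ∈ picked G, q.1 = v ∨ q.2 = v

theorem mem_solution {G : SimpleGraph (Fin n)} {v : Fin n} :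
    v ∈ solution n G ↔ ∃ q ∈ picked G, q.1 = v ∨ q.2 = v := by
  simp [solution]

theorem isPolyTime_solution : IsPolyTime solution := by
  refine computableInPolyTime_of_cmd Cmd.centroidal _ _ _ ?_ ?_
  · rintro ⟨n, G⟩
    rw [out_centroidal (lt := closer G) (fixed_init G) (fun x hx y hy => get_adj_init G hx hy)
      (fun a ha => by cases a <;> first | rfl | exact absurd rfl ha)
      (fun x hx a ha b hb => closer_iff_within G hx ha hb), encodeVertexSet,
      ← List.map_coe_finRange_eq_range, List.map_map]
    refine List.map_congr_left fun v _ => ?_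
    exact decide_eq_decide.2 mem_solution.symm
  · rintro ⟨n, G⟩
    rw [length_encodeGraph]
    simp only [encodeVertexSet, List.length_map, List.length_finRange]
    exact Nat.le_mul_of_pos_right n n.succ_pos

theorem separated_subset (G : SimpleGraph (Fin n)) (q : ℕ × ℕ) :
    separated n (closer G) q ⊆ (range n).offDiag := by
  rintro ⟨x, y⟩ h
  obtain ⟨⟨hx, hy⟩, h⟩ := mem_separated.1 h
  refine mem_offDiag.2 ⟨mem_range.2 hx, mem_range.2 hy, ?_⟩
  intro (e : x = y)
  exact h (e ▸ rfl)

theorem mem_separated_coe (G : SimpleGraph (Fin n)) (a b x y : Fin n) :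
    ((x : ℕ), (y : ℕ)) ∈ separated n (closer G) (a, b) ↔
      ¬(G.edist x a < G.edist x b ↔ G.edist y a < G.edist y b) := by
  rw [mem_separated, ← closer_iff, ← closer_iff, ← Bool.eq_iff_iff]
  simp

theorem card_offDiag_range_le (n : ℕ) : #(range n).offDiag ≤ n ^ 2 := by
  rw [offDiag_card, card_range, sq]
  exact Nat.sub_le _ _

/-- All ordered pairs from an optimal `B`, diagonal included; the loss against the binomial
coefficient affects only the constant. -/
theorem exists_cover (G : SimpleGraph (Fin n)) : ∃ D : Finset (ℕ × ℕ),
    (range n).offDiag ⊆ GreedyCover.covered (separated n (closer G)) D ∧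
      (∀ q ∈ D, q.1 < n ∧ q.2 < n) ∧ #D ≤ centroidalDim G ^ 2 := by
  obtain ⟨B, hB, hcard⟩ := exists_card_eq_centroidalDim G
  rw [isCentroidalLocating_iff] at hB
  refine ⟨(B ×ˢ B).image fun q => ((q.1 : ℕ), (q.2 : ℕ)), ?_, ?_, ?_⟩
  · rintro ⟨x, y⟩ h
    obtain ⟨hx, hy, hxy⟩ := mem_offDiag.1 h
    obtain ⟨a, ha, b, hb, hab⟩ := hB ⟨x, mem_range.1 hx⟩ ⟨y, mem_range.1 hy⟩
      (fun e => hxy (Fin.ext_iff.1 e))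
    exact mem_biUnion.2 ⟨_, mem_image.2 ⟨(a, b), mem_product.2 ⟨ha, hb⟩, rfl⟩,
      (mem_separated_coe G a b ⟨x, _⟩ ⟨y, _⟩).2 hab⟩
  · intro q hq
    obtain ⟨p, -, rfl⟩ := mem_image.1 hq
    exact ⟨p.1.2, p.2.2⟩
  · refine card_image_le.trans ?_
    rw [card_product, hcard, sq]

theorem card_offDiag_range_le_size (n : ℕ) : #(range n).offDiag ≤ n * (n + 1) :=
  (card_offDiag_range_le n).trans (by rw [sq]; exact Nat.mul_le_mul_left _ n.le_succ)

theorem isCentroidalLocating_solution (G : SimpleGraph (Fin n)) :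
    IsCentroidalLocating G (solution n G) := by
  obtain ⟨D, h1, h2, -⟩ := exists_cover G
  have h := GreedyCover.greedy_covers (fun a _ b _ => separated_subset G (a, b)) h1 h2
    (card_offDiag_range_le_size n)
  rw [isCentroidalLocating_iff]
  intro x y hxy
  have hmem : ((x : ℕ), (y : ℕ)) ∈ (range n).offDiag :=
    mem_offDiag.2 ⟨mem_range.2 x.2, mem_range.2 y.2, fun e => hxy (Fin.ext e)⟩
  obtain ⟨q, hq, hxy⟩ := mem_biUnion.1 (h hmem)
  obtain ⟨ha, hb⟩ := GreedyCover.greedy_subset _ q hq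
  exact ⟨⟨q.1, ha⟩, mem_solution.2 ⟨q, hq, Or.inl rfl⟩, ⟨q.2, hb⟩,
    mem_solution.2 ⟨q, hq, Or.inr rfl⟩, (mem_separated_coe G ⟨q.1, ha⟩ ⟨q.2, hb⟩ x y).1 hxy⟩

theorem card_solution_le_two_mul (G : SimpleGraph (Fin n)) : #(solution n G) ≤ 2 * #(picked G) := by
  have h : (solution n G).map Fin.valEmbedding ⊆ (picked G).biUnion fun q => {q.1, q.2} := by
    intro v hv
    obtain ⟨w, hw, rfl⟩ := mem_map.1 hv
    obtain ⟨q, hq, h⟩ := mem_solution.1 hw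
    refine mem_biUnion.2 ⟨q, hq, ?_⟩
    rcases h with h | h <;> simp [h]
  rw [← card_map Fin.valEmbedding, mul_comm]
  exact (card_le_card h).trans (card_biUnion_le_card_mul _ _ _ fun q _ => card_le_two)

/-- Each picked pair contributes at most two vertices, and the universe of ordered pairs has
logarithm at most `2 ln n`. -/
theorem card_solution_le_mul_sq (G : SimpleGraph (Fin n)) :
    (#(solution n G) : ℝ) ≤ 2 * (1 + 2 * Real.log n) * (centroidalDim G : ℝ) ^ 2 := by
  obtain ⟨D, h1, h2, h3⟩ := exists_cover G
  have h := GreedyCover.card_greedy_le (fun a _ b _ => separated_subset G (a, b)) h1 h2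
    (card_offDiag_range_le_size n)
  have hlog : Real.log #(range n).offDiag ≤ 2 * Real.log n := by
    rcases Nat.eq_zero_or_pos #(range n).offDiag with h0 | h0
    · rw [h0, Nat.cast_zero, Real.log_zero]
      exact mul_nonneg zero_le_two (Real.log_natCast_nonneg n)
    · rw [← Nat.cast_two, ← Real.log_pow]
      exact Real.log_le_log (by exact_mod_cast h0) (by exact_mod_cast card_offDiag_range_le n)
  have h4 : (#(solution n G) : ℝ) ≤ 2 * #(picked G) := by
    exact_mod_cast card_solution_le_two_mul G
  have h5 : (#D : ℝ) ≤ (centroidalDim G : ℝ) ^ 2 := by exact_mod_cast h3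
  have h6 := Real.log_natCast_nonneg n
  calc (#(solution n G) : ℝ) ≤ 2 * (#D * (1 + Real.log #(range n).offDiag)) :=
        h4.trans (mul_le_mul_of_nonneg_left h zero_le_two)
    _ ≤ 2 * ((centroidalDim G : ℝ) ^ 2 * (1 + 2 * Real.log n)) := by gcongr
    _ = _ := by ring

/-- The approximation ratio. -/
noncomputable def ratio (n : ℕ) : ℝ := √(2 * n * (1 + 2 * Real.log n))

theorem card_solution_le (G : SimpleGraph (Fin n)) :
    (#(solution n G) : ℝ) ≤ ratio n * centroidalDim G := by
  have h1 := card_solution_le_mul_sq G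
  have h2 : (#(solution n G) : ℝ) ≤ n := by
    have h := card_le_univ (solution n G)
    rw [Fintype.card_fin] at h
    exact_mod_cast h
  have h3 := Real.log_natCast_nonneg n
  have h4 : (0 : ℝ) ≤ #(solution n G) := Nat.cast_nonneg _
  refine abs_le_of_sq_le_sq' ?_ (by unfold ratio; positivity) |>.2
  -- One factor of the square is bounded by `n`, the other by the greedy estimate.
  rw [mul_pow, ratio, Real.sq_sqrt (by positivity), sq]
  calc (#(solution n G) : ℝ) * #(solution n G)
      ≤ n * (2 * (1 + 2 * Real.log n) * (centroidalDim G : ℝ) ^ 2) := by gcongr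
    _ = _ := by ring

theorem ratio_isBigO :
    ratio =O[Filter.atTop] fun n : ℕ => √((n : ℝ) * Real.log (n : ℝ)) := by
  -- For `n ≥ 3 > e` one has `ln n ≥ 1`, hence `2n (1 + 2 ln n) ≤ 6 n ln n`.
  refine Asymptotics.IsBigO.of_bound √6 (Filter.eventually_atTop.2 ⟨3, fun n hn => ?_⟩)
  have hn' : (3 : ℝ) ≤ n := by exact_mod_cast hn
  have hlog : 1 ≤ Real.log n := by
    rw [Real.le_log_iff_exp_le (by linarith)]
    exact Real.exp_one_lt_d9.le.trans (by linarith)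
  rw [Real.norm_of_nonneg (Real.sqrt_nonneg _), ratio, Real.norm_of_nonneg (Real.sqrt_nonneg _),
    ← Real.sqrt_mul (by norm_num)]
  refine Real.sqrt_le_sqrt ?_
  calc 2 * (n : ℝ) * (1 + 2 * Real.log n) ≤ 2 * n * (Real.log n + 2 * Real.log n) := by gcongr
    _ = _ := by ring

end CentroidalGreedy

theorem mainTheorem6 :
    (∃ α : ℕ → ℝ, α =O[Filter.atTop] (fun n : ℕ => Real.sqrt ((n : ℝ) * Real.log (n : ℝ))) ∧
      ∃ A : ∀ n : ℕ, SimpleGraph (Fin n) → Finset (Fin n), IsCentroidalApproxAlgorithm α A) ∧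
    ∀ (V : Type*) [Fintype V] [DecidableEq V] (G : SimpleGraph V),
      setCoverNumber (pairHypergraph G) ≤ (centroidalDim G).choose 2 ∧
      ∀ C : Finset (VertexPair V), IsSetCover (pairHypergraph G) C →
        IsCentroidalLocating G (pairUnion C) ∧ (pairUnion C).card ≤ 2 * C.card := by
  refine ⟨⟨CentroidalGreedy.ratio, CentroidalGreedy.ratio_isBigO, CentroidalGreedy.solution,
    CentroidalGreedy.isPolyTime_solution, fun n G =>
      ⟨CentroidalGreedy.isCentroidalLocating_solution G, CentroidalGreedy.card_solution_le G⟩⟩, ?_⟩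
  intro V _ _ G
  exact ⟨setCoverNumber_pairHypergraph_le G, fun C hC =>
    ⟨isCentroidalLocating_pairUnion G hC, card_pairUnion_le C⟩⟩
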